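/- Let $n\ge 1$ and let $a=(a_0,\dots,a_n)\in\mathbb Z^{n+1}$ be an integer vector whose amplitude satisfies $\max_i a_i-\min_i a_i\le M$, where $M\ge 0$ is an integer. For $s\ge 0$ let $D(s)\subset\mathbb R^s$ be the set of all $(y_1,\dots,y_s)$ such that for every $1\le j\le s-n$ the minimum $\min_{0\le i\le n}\{y_{j+i}+a_i\}$ is attained for at least two different values of $i$. It is a finite union of polyhedra; let $d_a(s)=\dim D(s)$ be its dimension (the tropical Hilbert function), and let $H=\lim_{s\to\infty}d_a(s)/s$ (the tropical entropy of $a$). Let $V$ be the number of vertices of the graph $G_a$, that is, the number of different non-empty sets $P\subset\mathbb R^n$ that arise as follows. Choose a non-empty set $B\subset\{1,\dots,n\}$ (the bounded coordinates) and $s_0\in B$; for each pair $k<l$ in $B$ choose an integer $m(k,l)$ with $(k-2n)M\le m(k,l)\le(2n-k)M$ and one of the two conditions $y_k=y_l+m(k,l)$ or $y_k<y_l+m(k,l)<y_k+1$. Then $P$ is the set of all $(y_1,\dots,y_n)\in\mathbb R^n$ that satisfy the chosen conditions, $y_{s_0}\le y_j$ for all $1\le j\le n$, and $y_j-y_{s_0}>jM$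 for all $j\notin B$. **Theorem.** There is an absolute constant $C>0$ such that, for all $n$, $M$, $a$ as above, the limit $H$ exists and there is an integer $R$ with $$1\le R<\exp\bigl((C\max\{M,1\}\,n)^n\bigr)$$ such that for all integers $s>(V^2+1)(V+n)+V((1-H)V+n+1)^2$ $$d_a(s+R)=d_a(s)+HR .$$ -/

import Mathlib

open Filter Topology

/-- The minimum of the numbers `b 0, …, b n` is attained for at least two different indices. -/
def MinAttainedTwice {n : ℕ} (b : Fin (n + 1) → ℝ) : Prop :=
  ∃ i₁ i₂ : Fin (n + 1), i₁ ≠ i₂ ∧ (∀ k, b i₁ ≤ b k) ∧ (∀ k, b i₂ ≤ b k)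

/-- `D(s) ⊆ ℝ^s`: the tropical recurrent sequences of length `s` satisfying `a = (a_0, …, a_n)`.
Sequences are indexed from `0`, so the windows are `y_j, …, y_{j+n}` with `j + n ≤ s - 1`. -/
def tropicalRecurrent {n : ℕ} (a : Fin (n + 1) → ℤ) (s : ℕ) : Set (Fin s → ℝ) :=
  {y | ∀ (j : ℕ) (hj : j + n < s),
    MinAttainedTwice fun i : Fin (n + 1) =>
      y ⟨j + i, lt_of_le_of_lt (Nat.add_le_add_left (Nat.lt_succ_iff.mp i.isLt) j) hj⟩ + (a i : ℝ)}

/-- The dimension of a finite union `X` of polyhedra in `ℝ^s`: the largest dimension (of the affine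
hull) of a convex subset of `X`. (A convex subset of `X` is covered by the finitely many polyhedra,
one of which therefore has at least its dimension, so that this is the largest dimension of one
of these polyhedra.) The dimensions are bounded by `s`, so the supremum is a maximum. -/
noncomputable def polyhedralDim {s : ℕ} (X : Set (Fin s → ℝ)) : ℕ :=
  sSup {k : ℕ | ∃ C : Set (Fin s → ℝ), Convex ℝ C ∧ C ⊆ X ∧
    k = Module.finrank ℝ (affineSpan ℝ C).direction}

/-- The tropical Hilbert function `d_a(s) = dim D(s)`. -/
noncomputable def tropicalHilbert {n : ℕ} (a : Fin (n + 1) → ℤ) (s : ℕ) : ℕ :=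
  polyhedralDim (tropicalRecurrent a s)

/-- The tropical entropy `H(a) = lim d_a(s) / s`. -/
noncomputable def tropicalEntropy {n : ℕ} (a : Fin (n + 1) → ℤ) : ℝ :=
  limUnder atTop fun s : ℕ => (tropicalHilbert a s : ℝ) / (s : ℝ)

/-- The data by which a vertex of the graph `G_a` is described, for coordinates `y_1, …, y_n`
(the coordinate `y_j` has the index `j - 1 : Fin n`): the set of bounded coordinates (the other ones
are called unbounded), a distinguished bounded coordinate, and for each pair of bounded
coordinates an integer together with the choice between an equality and inequalities. -/
structure VertexData (n : ℕ) where
  /-- the set of the bounded coordinates -/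
  bdd : Set (Fin n)
  /-- the distinguished bounded coordinate, required to be minimal -/
  s₀ : Fin n
  s₀_mem : s₀ ∈ bdd
  /-- the integers `m(k,l)`, of which only those for bounded `k < l` are used -/
  m : Fin n → Fin n → ℤ
  /-- whether an equality is chosen for the pair `k, l` -/
  isEq : Fin n → Fin n → Prop

namespace VertexData

variable {n : ℕ}

/-- The range `(k - 2n)M ≤ m(k,l) ≤ (2n - k)M` of the integers, `k` being counted from `1`. -/
def InRange (v : VertexData n) (M : ℕ) : Prop :=
  ∀ k l : Fin n, k ∈ v.bdd → l ∈ v.bdd → k < l →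
    (((k : ℤ) + 1) - 2 * n) * M ≤ v.m k l ∧ v.m k l ≤ (2 * n - ((k : ℤ) + 1)) * M

/-- The polyhedron `P_v`. -/
def poly (v : VertexData n) (M : ℕ) : Set (Fin n → ℝ) :=
  {y | (∀ j, y v.s₀ ≤ y j) ∧
    (∀ k l, k ∈ v.bdd → l ∈ v.bdd → k < l →
      (v.isEq k l → y k = y l + v.m k l) ∧
      (¬ v.isEq k l → y k < y l + v.m k l ∧ y l + v.m k l < y k + 1)) ∧
    (∀ j, j ∉ v.bdd → (((j : ℕ) : ℝ) + 1) * M < y j - y v.s₀)}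

end VertexData

/-- The vertices of the graph `G_a`, each given by its polyhedron; the empty polyhedron is
ignored. The vertices depend on `a` only through `n` and the bound `M` on the amplitude. -/
def graphVertices (n M : ℕ) : Set (Set (Fin n → ℝ)) :=
  {P | P.Nonempty ∧ ∃ v : VertexData n, v.InRange M ∧ P = v.poly M}

/-- There are only finitely many vertices. -/
theorem graphVertices_finite (n M : ℕ) : (graphVertices n M).Finite := by
  classical
  set N : ℤ := 2 * n * M with hN
  let T : Set (Fin n → Fin n → ℤ) :=
    Set.pi Set.univ fun _ => Set.pi Set.univ fun _ => Set.Icc (-N) N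
  have hT : T.Finite := Set.Finite.pi fun _ => Set.Finite.pi fun _ => Set.finite_Icc _ _
  let f : (Set (Fin n) × Fin n × (Fin n → Fin n → Prop)) × (Fin n → Fin n → ℤ) →
      Set (Fin n → ℝ) := fun p =>
    if h : p.1.2.1 ∈ p.1.1 then (VertexData.mk p.1.1 p.1.2.1 h p.2 p.1.2.2).poly M else ∅
  refine ((Set.finite_univ.prod hT).image f).subset ?_
  rintro P ⟨-, v, hv, rfl⟩
  refine ⟨((v.bdd, v.s₀, v.isEq),
    fun k l => if k ∈ v.bdd ∧ l ∈ v.bdd ∧ k < l then v.m k l else 0), ⟨trivial, ?_⟩, ?_⟩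
  · intro k _ l _
    have hN0 : 0 ≤ N := by positivity
    dsimp only
    split_ifs with h
    · obtain ⟨h1, h2⟩ := hv k l h.1 h.2.1 h.2.2
      have hk : (0 : ℤ) ≤ ((k : ℤ) + 1) * M := by positivity
      constructor <;> rw [hN] <;> nlinarith
    · exact ⟨by linarith, hN0⟩
  · simp only [f, v.s₀_mem, dif_pos]
    ext y
    simp only [VertexData.poly, Set.mem_ofPred_eq]
    refine and_congr Iff.rfl (and_congr ?_ Iff.rfl)
    refine forall₂_congr fun k l => forall_congr' fun hk => forall_congr' fun hl =>
      forall_congr' fun hkl => ?_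
    rw [if_pos ⟨hk, hl, hkl⟩]

/-- The number `V` of vertices of the graph `G_a`. -/
noncomputable def numVertices (n M : ℕ) : ℕ := (graphVertices n M).ncard

/-! The dimension of `D(s)` is the maximum over `y ∈ D(s)` of the number of classes of the numbers
`y i` modulo integers. Indeed, shifting the classes of `y` independently by small amounts does not
leave `D(s)`, as two coordinates at which a minimum is attained are congruent; conversely, at a point
`y` of a convex subset with as few integer differences `y i - y j` as possible, these
differences are constant on the subset (`numClasses_le_tropicalHilbert`,
`exists_tropicalHilbert_le`).

The classes are counted while the sequence is produced term by term. The terms that can follow a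
window of `n` terms depend only on its type: the set of its bounded coordinates and the floors of
their differences (`exists_transfer`, `windowType_succ_eq`). Bounded coordinates are chosen such that
an unbounded one influences no minimum and stays unbounded until it leaves the window. Hence
`d_a(t + n)` is the maximal value of walks of length `t` in a finite graph of types, with edges of
weight `0` and `1`, where weight `1` stands for a new class (`isMaxWeight_tropicalHilbert`). The
types are vertices of `G_a`, so that their number `N` is at most `V`; moreover
`N ≤ (4 n² max (M, 1)) ^ n`, because a type is encoded by a set, floors, and the ranks of fractional
parts.

The maximal mean weight `H = p / q` of closed walks is the entropy. Walks are compared by their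
defect `p l - q k`, where `l` is the length and `k` the weight; it is nonnegative for closed walks.
A walk that avoids all closed walks of defect `0` has a defect that grows like `l / N`, so a long
optimal walk meets a component of the critical graph, the union of the closed walks of defect `0`.
This component contains a closed walk of defect `0` and of length `c`, where `c` is at most the size
of the component. The optimal walk can be led through this closed walk, shortened by closed walks of
lengths divisible by `c` until it is short (`Walk.exists_reduced`), and then lengthened to any large
length in the same class modulo `c` (`exists_walk_modEq`). So the product `R` of the different
values of `c` is a period (`IsMaxWeight.add_period`). As the components are disjoint, these values
have a sum of at most `N`, there are at most `√(2 N)` of them, and `R ≤ N ^ √(2 N)`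
(`exists_common_period`), which has the required size (`pow_lt_exp`). -/

/-! ### Walks in a finite weighted graph -/

/-- `Walk E u v l k`: there is a walk from `u` to `v` of length `l` and total weight `k` in the
directed graph in which `E u v b` says that there is an edge of weight `b` from `u` to `v`. -/
inductive Walk {Q : Type*} (E : Q → Q → ℕ → Prop) : Q → Q → ℕ → ℕ → Prop
  | nil (u : Q) : Walk E u u 0 0
  | snoc {u v x : Q} {l k b : ℕ} : Walk E u v l k → E v x b → Walk E u x (l + 1) (k + b)

namespace Walk

variable {Q : Type*} {E : Q → Q → ℕ → Prop}

theorem append {u v x : Q} {l k l' k' : ℕ} (h : Walk E u v l k) (h' : Walk E v x l' k') :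
    Walk E u x (l + l') (k + k') := by
  induction h' with
  | nil => exact h
  | snoc _ e ih => simpa only [add_assoc] using ih.snoc e

theorem mono {E' : Q → Q → ℕ → Prop} (hE : ∀ u v b, E u v b → E' u v b) {u v : Q} {l k : ℕ}
    (h : Walk E u v l k) : Walk E' u v l k := by
  induction h with
  | nil => exact .nil _
  | snoc _ e ih => exact ih.snoc (hE _ _ _ e)

theorem iterate {u : Q} {l k : ℕ} (h : Walk E u u l k) (r : ℕ) :
    Walk E u u (r * l) (r * k) := by
  induction r with
  | zero => simpa using Walk.nil u
  | succ r ih => simpa [Nat.succ_mul] using ih.append h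

theorem weight_le (hb : ∀ u v b, E u v b → b ≤ 1) {u v : Q} {l k : ℕ} (h : Walk E u v l k) :
    k ≤ l := by
  induction h with
  | nil => exact le_rfl
  | snoc _ e ih => exact Nat.add_le_add ih (hb _ _ _ e)

/-- The vertices `f i` that a walk visits, and the weights `K i` of its initial segments. -/
theorem exists_positions {u v : Q} {l k : ℕ} (h : Walk E u v l k) :
    ∃ (f : ℕ → Q) (K : ℕ → ℕ), f 0 = u ∧ f l = v ∧ K 0 = 0 ∧ K l = k ∧
      ∀ i < l, ∃ b, E (f i) (f (i + 1)) b ∧ K (i + 1) = K i + b := by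
  induction h with
  | nil => exact ⟨fun _ => u, fun _ => 0, rfl, rfl, rfl, rfl, by simp⟩
  | @snoc v x l k b _ e ih =>
    obtain ⟨f, K, h0, hl, hK0, hKl, hs⟩ := ih
    refine ⟨fun i => if i ≤ l then f i else x, fun i => if i ≤ l then K i else k + b,
      by simpa using h0, by simp, by simpa using hK0, by simp, fun i hi => ?_⟩
    rcases Nat.lt_succ_iff_lt_or_eq.mp hi with hi | rfl
    · have h1 : i + 1 ≤ l := hi
      simpa [hi.le, h1] using hs i hi
    · refine ⟨b, ?_, ?_⟩ <;> simp [hl, hKl, e]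

theorem of_positions {f : ℕ → Q} {K : ℕ → ℕ} {l : ℕ}
    (hs : ∀ i < l, ∃ b, E (f i) (f (i + 1)) b ∧ K (i + 1) = K i + b) (i d : ℕ) (hd : i + d ≤ l) :
    K i ≤ K (i + d) ∧ Walk E (f i) (f (i + d)) d (K (i + d) - K i) := by
  induction d with
  | zero => simpa using Walk.nil (f i)
  | succ d ih =>
    obtain ⟨h1, h2⟩ := ih (by omega)
    obtain ⟨b, hb, hK⟩ := hs (i + d) (by omega)
    rw [← add_assoc, hK]
    refine ⟨by omega, ?_⟩
    rw [show K (i + d) + b - K i = K (i + d) - K i + b by omega]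
    exact h2.snoc hb

/-- A long walk revisits a vertex after a number of steps divisible by `c`: by the pigeonhole
principle for the pairs (vertex, position modulo `c`). -/
theorem exists_closed [DecidableEq Q] (S : Finset Q) (hS : ∀ u v b, E u v b → u ∈ S ∧ v ∈ S)
    {c : ℕ} (hc : 0 < c) {u v : Q} {l k : ℕ} (h : Walk E u v l k) (hl0 : 0 < l)
    (hl : c * S.card ≤ l) :
    ∃ x l₁ k₁ l₂ k₂ l₃ k₃, Walk E u x l₁ k₁ ∧ Walk E x x l₂ k₂ ∧ Walk E x v l₃ k₃ ∧
      0 < l₂ ∧ l₂ ≤ c * S.card ∧ c ∣ l₂ ∧ l = l₁ + l₂ + l₃ ∧ k = k₁ + k₂ + k₃ := by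
  obtain ⟨f, K, h0, hfl, hK0, hKl, hs⟩ := h.exists_positions
  have hmem : ∀ i ≤ l, f i ∈ S := by
    intro i hi
    rcases hi.lt_or_eq with hi | rfl
    · obtain ⟨b, hb, -⟩ := hs i hi
      exact (hS _ _ _ hb).1
    · obtain ⟨b, hb, -⟩ := hs (i - 1) (by omega)
      have := (hS _ _ _ hb).2
      rwa [Nat.sub_add_cancel hl0] at this
  obtain ⟨i, hi, j, hj, hij, heq⟩ := Finset.exists_ne_map_eq_of_card_lt_of_maps_to
    (s := Finset.range (c * S.card + 1)) (t := S ×ˢ Finset.range c)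
    (f := fun i => (f i, i % c)) (by simp [mul_comm]) (by
      intro i hi
      have hi : i < c * S.card + 1 := by simpa using hi
      simpa using ⟨hmem i (by omega), Nat.mod_lt _ hc⟩)
  wlog hlt : i < j generalizing i j
  · exact this j hj i hi hij.symm heq.symm (by omega)
  simp only [Finset.mem_range] at hi hj
  simp only [Prod.mk.injEq] at heq
  obtain ⟨a1, w1⟩ := of_positions hs 0 i (by omega)
  obtain ⟨a2, w2⟩ := of_positions hs i (j - i) (by omega)
  obtain ⟨a3, w3⟩ := of_positions hs j (l - j) (by omega)
  rw [Nat.add_sub_cancel' hlt.le] at a2 w2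
  rw [Nat.add_sub_cancel' (by omega)] at a3 w3
  rw [zero_add] at a1 w1
  rw [← heq.1] at w2 w3
  rw [h0] at w1
  rw [hfl] at w3
  refine ⟨f i, _, _, _, _, _, _, w1, w2, w3, by omega, by omega, ?_, by omega, by omega⟩
  exact (Nat.modEq_iff_dvd' hlt.le).mp heq.2

end Walk

/-! ### Maximal cycle means -/

/-- `p / q` is the maximal mean weight of a closed walk, and is attained by a closed walk whose
length `q` is at most the number of vertices. -/
structure IsMaxMean {Q : Type*} [Fintype Q] (E : Q → Q → ℕ → Prop) (p q : ℕ) : Prop where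
  pos : 0 < q
  le_card : q ≤ Fintype.card Q
  attained : ∃ x, Walk E x x q p
  max : ∀ x l k, Walk E x x l k → q * k ≤ p * l

section

variable {Q : Type*} {E : Q → Q → ℕ → Prop}

theorem exists_walk_of_length (hE : ∀ u, ∃ v b, E u v b) (u : Q) (l : ℕ) :
    ∃ v k, Walk E u v l k := by
  induction l with
  | zero => exact ⟨u, 0, .nil u⟩
  | succ l ih =>
    obtain ⟨v, k, h⟩ := ih
    obtain ⟨x, b, hb⟩ := hE v
    exact ⟨x, _, h.snoc hb⟩

theorem exists_isMaxMean [Fintype Q] [Nonempty Q] (hE : ∀ u, ∃ v b, E u v b)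
    (hb : ∀ u v b, E u v b → b ≤ 1) : ∃ p q, IsMaxMean E p q := by
  classical
  set N := Fintype.card Q with hN
  have hN0 : 0 < N := Fintype.card_pos
  let T : Set (ℕ × ℕ) := {z | 0 < z.1 ∧ z.1 ≤ N ∧ ∃ x, Walk E x x z.1 z.2}
  have hT : T.Finite := by
    refine ((Set.finite_Iic N).prod (Set.finite_Iic N)).subset ?_
    rintro ⟨l, k⟩ ⟨-, h1, x, hx⟩
    exact ⟨h1, (hx.weight_le hb).trans h1⟩
  have hclosed : ∀ {u v l k}, Walk E u v l k → N ≤ l →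
      ∃ x l₁ k₁ l₂ k₂ l₃ k₃, Walk E u x l₁ k₁ ∧ Walk E x x l₂ k₂ ∧ Walk E x v l₃ k₃ ∧
      0 < l₂ ∧ l₂ ≤ N ∧ l = l₁ + l₂ + l₃ ∧ k = k₁ + k₂ + k₃ := by
    intro u v l k h hl
    obtain ⟨x, l₁, k₁, l₂, k₂, l₃, k₃, w1, w2, w3, h1, h2, -, h3, h4⟩ :=
      h.exists_closed Finset.univ (by simp) Nat.one_pos (by omega) (by simpa using hl)
    exact ⟨x, l₁, k₁, l₂, k₂, l₃, k₃, w1, w2, w3, h1, by simpa using h2, h3, h4⟩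
  have hne : T.Nonempty := by
    obtain ⟨u⟩ := ‹Nonempty Q›
    obtain ⟨v, k, h⟩ := exists_walk_of_length hE u N
    obtain ⟨x, -, -, l₂, k₂, -, -, -, w, -, h1, h2, -⟩ := hclosed h le_rfl
    exact ⟨(l₂, k₂), h1, h2, x, w⟩
  obtain ⟨⟨q, p⟩, ⟨hq0, hqN, hx⟩, hmax⟩ :=
    Set.exists_max_image T (fun z => (z.2 : ℚ) / z.1) hT hne
  refine ⟨p, q, hq0, hqN, hx, ?_⟩
  have hmax' : ∀ x l k, 0 < l → l ≤ N → Walk E x x l k → q * k ≤ p * l := by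
    intro x l k hl hlN hw
    have h1 : (k : ℚ) / l ≤ p / q := hmax (l, k) ⟨hl, hlN, x, hw⟩
    rw [div_le_div_iff₀ (by exact_mod_cast hl) (by exact_mod_cast hq0)] at h1
    rw [mul_comm q]
    exact_mod_cast h1
  intro x l
  induction l using Nat.strong_induction_on generalizing x with
  | _ l ih =>
    intro k hw
    rcases Nat.eq_zero_or_pos l with rfl | hl
    · obtain rfl : k = 0 := Nat.le_zero.mp (hw.weight_le hb)
      simp
    rcases le_or_gt l N with hlN | hlN
    · exact hmax' x l k hl hlN hw
    obtain ⟨z, l₁, k₁, l₂, k₂, l₃, k₃, w1, w2, w3, h1, h2, h3, h4⟩ := hclosed hw hlN.le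
    have e1 := hmax' z l₂ k₂ h1 h2 w2
    have e2 := ih (l₁ + l₃) (by omega) x _ (w1.append w3)
    subst h3 h4
    nlinarith

/-- A vertex is critical if it lies on a closed walk of maximal mean weight `p / q`. -/
def IsCritical (E : Q → Q → ℕ → Prop) (p q : ℕ) (u : Q) : Prop :=
  ∃ l k, 0 < l ∧ Walk E u u l k ∧ q * k = p * l

/-- Two vertices are linked if they lie on a common closed walk of maximal mean weight. -/
def Linked (E : Q → Q → ℕ → Prop) (p q : ℕ) (u v : Q) : Prop :=
  ∃ l k l' k', Walk E u v l k ∧ Walk E v u l' k' ∧ q * (k + k') = p * (l + l')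

theorem Linked.refl {p q : ℕ} (u : Q) : Linked E p q u u :=
  ⟨0, 0, 0, 0, .nil u, .nil u, by simp⟩

theorem Linked.symm {p q : ℕ} {u v : Q} (h : Linked E p q u v) : Linked E p q v u := by
  obtain ⟨l, k, l', k', h1, h2, h3⟩ := h
  exact ⟨l', k', l, k, h2, h1, by rw [add_comm k', add_comm l', h3]⟩

theorem Linked.trans {p q : ℕ} {u v x : Q} (h : Linked E p q u v) (h' : Linked E p q v x) :
    Linked E p q u x := by
  obtain ⟨l, k, l', k', h1, h2, h3⟩ := h
  obtain ⟨m, j, m', j', g1, g2, g3⟩ := h'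
  exact ⟨_, _, _, _, h1.append g1, g2.append h2, by linear_combination h3 + g3⟩

variable [Fintype Q]

/-- The vertices linked to `u`: the component of `u` in the critical graph. -/
noncomputable def linkedSet (E : Q → Q → ℕ → Prop) (p q : ℕ) (u : Q) : Finset Q :=
  open Classical in Finset.univ.filter (Linked E p q u)

theorem mem_linkedSet {p q : ℕ} {u v : Q} : v ∈ linkedSet E p q u ↔ Linked E p q u v := by
  classical
  simp [linkedSet]

/-- A closed walk of maximal mean runs inside the component of its starting point. -/
theorem Walk.restrict_linkedSet {p q : ℕ} {u v : Q} {l k l' k' : ℕ} (h : Walk E u v l k)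
    (h' : Walk E v u l' k') (hk : q * (k + k') = p * (l + l')) :
    Walk (fun x y b => E x y b ∧ x ∈ linkedSet E p q u ∧ y ∈ linkedSet E p q u) u v l k := by
  induction h generalizing l' k' with
  | nil => exact .nil _
  | @snoc v x l k b h e ih =>
    have h1 : Walk E v x (0 + 1) (0 + b) := (Walk.nil v).snoc e
    have h2 : q * (k + (0 + b + k')) = p * (l + (0 + 1 + l')) := by
      rw [show k + (0 + b + k') = k + b + k' by ring, hk]; ring
    exact (ih (h1.append h') h2).snoc ⟨e, mem_linkedSet.2 ⟨_, _, _, _, h, h1.append h', h2⟩,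
      mem_linkedSet.2 ⟨_, _, _, _, h.snoc e, h', hk⟩⟩

/-- The component of a critical vertex contains a critical closed walk that is not longer than
the component is large. -/
theorem exists_short_critical {p q : ℕ} (hm : IsMaxMean E p q) {u : Q} (hu : IsCritical E p q u) :
    ∃ x c k, Linked E p q u x ∧ 0 < c ∧ c ≤ (linkedSet E p q u).card ∧ Walk E x x c k ∧
      q * k = p * c := by
  classical
  let T : ℕ → Prop := fun l => 0 < l ∧ ∃ x k, Linked E p q u x ∧ Walk E x x l k ∧ q * k = p * l
  have hT : ∃ l, T l := by
    obtain ⟨l, k, hl, hw, hk⟩ := hu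
    exact ⟨l, hl, u, k, Linked.refl u, hw, hk⟩
  obtain ⟨hl, x, k, hx, hw, hk⟩ := Nat.find_spec hT
  set l := Nat.find hT with hldef
  refine ⟨x, l, k, hx, hl, ?_, hw, hk⟩
  by_contra! hlt
  have hset : linkedSet E p q x = linkedSet E p q u := by
    ext y
    rw [mem_linkedSet, mem_linkedSet]
    exact ⟨fun h => hx.trans h, fun h => hx.symm.trans h⟩
  have hr := hw.restrict_linkedSet (p := p) (q := q) (Walk.nil x) (by simpa using hk)
  obtain ⟨z, l₁, k₁, l₂, k₂, l₃, k₃, w1, w2, w3, h1, h2, -, h3, h4⟩ :=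
    hr.exists_closed (linkedSet E p q x) (fun _ _ _ h => h.2) Nat.one_pos hl
      (by rw [hset]; omega)
  replace w1 := w1.mono (E' := E) fun _ _ _ h => h.1
  replace w2 := w2.mono (E' := E) fun _ _ _ h => h.1
  replace w3 := w3.mono (E' := E) fun _ _ _ h => h.1
  have e1 := hm.max _ _ _ w2
  have e2 := hm.max _ _ _ (w1.append w3)
  have e3 : q * k₂ = p * l₂ := by rw [h3, h4] at hk; nlinarith
  have e4 : q * (k₁ + (k₂ + k₃)) = p * (l₁ + (l₂ + l₃)) := by
    rw [← add_assoc, ← add_assoc, ← h3, ← h4, hk]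
  have hz : Linked E p q u z := hx.trans ⟨_, _, _, _, w1, w2.append w3, e4⟩
  have := Nat.find_min' hT (m := l₂) ⟨h1, z, k₂, hz, w2, e3⟩
  rw [hset] at h2
  omega

/-- Cutting closed walks out of a walk shortens it to fewer than `c N` steps without changing its
length modulo `c` and without increasing its defect `p l - q k`. -/
theorem Walk.exists_reduced {p q c : ℕ} (hm : IsMaxMean E p q) (hc : 0 < c) {u v : Q} {l k : ℕ}
    (h : Walk E u v l k) :
    ∃ l' k', Walk E u v l' k' ∧ l' < c * Fintype.card Q ∧ l' ≡ l [MOD c] ∧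
      q * k + p * l' ≤ q * k' + p * l := by
  classical
  induction l using Nat.strong_induction_on generalizing k with
  | _ l ih =>
    rcases lt_or_ge l (c * Fintype.card Q) with hl | hl
    · exact ⟨l, k, h, hl, rfl, le_rfl⟩
    have hN : 0 < c * Fintype.card Q := Nat.mul_pos hc (hm.pos.trans_le hm.le_card)
    obtain ⟨x, l₁, k₁, l₂, k₂, l₃, k₃, w1, w2, w3, h1, -, ⟨d, h2⟩, h3, h4⟩ :=
      h.exists_closed Finset.univ (by simp) hc (by omega) (by simpa using hl)
    obtain ⟨l', k', w, g1, g2, g3⟩ := ih (l₁ + l₃) (by omega) (w1.append w3)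
    refine ⟨l', k', w, g1, g2.trans ?_, ?_⟩
    · rw [h3, show l₁ + l₂ + l₃ = l₁ + l₃ + c * d by omega]
      simp [Nat.ModEq]
    · have := hm.max _ _ _ w2
      subst h3 h4
      nlinarith

/-- A walk through a vertex of the component of a closed walk of length `c` and maximal mean can be
replaced by a walk of any sufficiently large length in the same residue class modulo `c`, with
no larger defect. -/
theorem exists_walk_modEq {p q : ℕ} (hm : IsMaxMean E p q) {c kc : ℕ} (hc : 0 < c)
    {u v w x : Q} {l₁ k₁ l₂ k₂ : ℕ} (h₁ : Walk E u w l₁ k₁) (h₂ : Walk E w v l₂ k₂)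
    (hx : Linked E p q w x) (hcx : Walk E x x c kc) (hkc : q * kc = p * c) {t : ℕ}
    (ht : 2 * (c * Fintype.card Q) ≤ t) (hmod : t ≡ l₁ + l₂ [MOD c]) :
    ∃ k, Walk E u v t k ∧ q * (k₁ + k₂) + p * t ≤ q * k + p * (l₁ + l₂) := by
  obtain ⟨m, j, m', j', hwx, hxw, hj⟩ := hx
  -- The detour to `x` is made `c` times in order not to change the length modulo `c`.
  obtain ⟨c, rfl⟩ : ∃ d, c = d + 1 := ⟨c - 1, by omega⟩
  obtain ⟨a, ka, wa, a1, a2, a3⟩ := (h₁.append hwx).exists_reduced hm hc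
  obtain ⟨b, kb, wb, b1, b2, b3⟩ :=
    (((hxw.append hwx).iterate c).append (hxw.append h₂)).exists_reduced hm hc
  have hmod' : a + b ≡ t [MOD (c + 1)] := by
    refine (a2.add b2).trans (Nat.ModEq.trans ?_ hmod.symm)
    rw [show l₁ + m + (c * (m' + m) + (m' + l₂)) = l₁ + l₂ + (c + 1) * (m + m') by ring]
    simp [Nat.ModEq]
  obtain ⟨d, hd⟩ := (Nat.modEq_iff_dvd' (by omega)).mp hmod'
  have hd' : t = a + d * (c + 1) + b := by rw [mul_comm d]; omega
  refine ⟨_, hd' ▸ (wa.append (hcx.iterate d)).append wb, ?_⟩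
  rw [hd']
  zify at *
  linear_combination a3 + b3 - (c + 1) * hj - d * hkc

end

/-! ### Eventual periodicity of the maximal weight of walks -/

section

variable {Q : Type*} {E : Q → Q → ℕ → Prop}

/-- A walk either passes through a critical vertex, or all its edges avoid these vertices. -/
theorem Walk.critical_or_avoids {p q : ℕ} {u v : Q} {l k : ℕ} (h : Walk E u v l k) :
    (∃ w l₁ k₁ l₂ k₂, IsCritical E p q w ∧ Walk E u w l₁ k₁ ∧ Walk E w v l₂ k₂ ∧
      l = l₁ + l₂ ∧ k = k₁ + k₂) ∨
    Walk (fun x y b => E x y b ∧ ¬ IsCritical E p q x ∧ ¬ IsCritical E p q y) u v l k := by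
  induction h with
  | nil => exact .inr (.nil _)
  | @snoc v x l k b h e ih =>
    rcases ih with ⟨w, l₁, k₁, l₂, k₂, hw, h1, h2, h3, h4⟩ | ih
    · exact .inl ⟨w, l₁, k₁, _, _, hw, h1, h2.snoc e, by omega, by omega⟩
    by_cases hv : IsCritical E p q v
    · exact .inl ⟨v, l, k, _, _, hv, h, (Walk.nil v).snoc e, by omega, by omega⟩
    by_cases hx : IsCritical E p q x
    · exact .inl ⟨x, _, _, 0, 0, hx, h.snoc e, .nil x, rfl, rfl⟩
    exact .inr (ih.snoc ⟨e, hv, hx⟩)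

variable [Fintype Q]

theorem IsMaxMean.le {p q : ℕ} (hm : IsMaxMean E p q) (hb : ∀ u v b, E u v b → b ≤ 1) : p ≤ q := by
  obtain ⟨x, hx⟩ := hm.attained
  exact hx.weight_le hb

/-- A walk differs from closed walks by fewer than `N` edges, of weight at most `1`. -/
theorem Walk.weight_le_of_isMaxMean {p q : ℕ} (hm : IsMaxMean E p q)
    (hb : ∀ u v b, E u v b → b ≤ 1) {u v : Q} {l k : ℕ} (h : Walk E u v l k) :
    q * k + p * Fintype.card Q ≤ p * l + q * Fintype.card Q := by
  obtain ⟨l', k', w, h1, -, h2⟩ := h.exists_reduced hm Nat.one_pos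
  have h3 := w.weight_le hb
  have h4 := hm.le hb
  obtain ⟨e, he⟩ := Nat.exists_eq_add_of_le h4
  rw [one_mul] at h1
  have h5 : q * k' ≤ q * l' := Nat.mul_le_mul_left _ h3
  have h6 : e * l' ≤ e * Fintype.card Q := Nat.mul_le_mul_left _ h1.le
  subst he
  nlinarith

/-- Each closed walk that avoids the critical vertices has a defect `p l - q k` of at least `1`, so
that the defect of a walk that avoids them grows linearly with its length. -/
theorem Walk.weight_le_of_avoids {p q : ℕ} (hm : IsMaxMean E p q)
    (hb : ∀ u v b, E u v b → b ≤ 1) {u v : Q} {l k : ℕ}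
    (h : Walk (fun x y b => E x y b ∧ ¬ IsCritical E p q x ∧ ¬ IsCritical E p q y) u v l k) :
    Fintype.card Q * (q * k + p * Fintype.card Q) + l ≤
      Fintype.card Q * (p * l + q * Fintype.card Q) + Fintype.card Q := by
  classical
  set N := Fintype.card Q with hN
  induction l using Nat.strong_induction_on generalizing k with
  | _ l ih =>
    rcases le_or_gt l N with hl | hl
    · have h3 : k ≤ l := (h.mono (E' := E) fun _ _ _ h => h.1).weight_le hb
      obtain ⟨e, he⟩ := Nat.exists_eq_add_of_le (hm.le hb)
      have h5 : q * k ≤ q * l := Nat.mul_le_mul_left _ h3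
      have h6 : e * l ≤ e * N := Nat.mul_le_mul_left _ hl
      have h7 : q * k + p * N ≤ p * l + q * N := by subst he; nlinarith
      exact Nat.add_le_add (Nat.mul_le_mul_left _ h7) hl
    obtain ⟨x, l₁, k₁, l₂, k₂, l₃, k₃, w1, w2, w3, h1, h2, -, h3, h4⟩ :=
      h.exists_closed Finset.univ (by simp) Nat.one_pos (by omega) (by simpa using hl.le)
    rw [Finset.card_univ, ← hN, one_mul] at h2
    have hx : ¬ IsCritical E p q x := by
      cases w2 with
      | nil => omega
      | snoc _ e => exact e.2.2
    have w2' := w2.mono (E' := E) fun _ _ _ h => h.1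
    have h5 : q * k₂ + 1 ≤ p * l₂ := by
      have := hm.max _ _ _ w2'
      refine Nat.lt_of_le_of_ne this fun h => hx ⟨_, _, h1, w2', h⟩
    have h6 := ih (l₁ + l₃) (by omega) (w1.append w3)
    have h7 : N * (q * k₂ + 1) ≤ N * (p * l₂) := Nat.mul_le_mul_left _ h5
    subst h3 h4
    nlinarith

/-- Running along a closed walk of maximal mean gives walks of any length with a bounded defect. -/
theorem IsMaxMean.exists_walk {p q : ℕ} (hm : IsMaxMean E p q)
    (hE : ∀ u, ∃ v b, E u v b) (t : ℕ) :
    ∃ u v k, Walk E u v t k ∧ p * t ≤ q * k + p * q := by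
  obtain ⟨x, hx⟩ := hm.attained
  obtain ⟨v, k, hk⟩ := exists_walk_of_length hE x (t % q)
  refine ⟨x, v, t / q * p + k, ?_, ?_⟩
  · have := (hx.iterate (t / q)).append hk
    rwa [Nat.div_add_mod'] at this
  · have h1 : p * (t % q) ≤ p * q := Nat.mul_le_mul_left _ (Nat.mod_lt _ hm.pos).le
    calc p * t = p * (q * (t / q) + t % q) := by rw [Nat.div_add_mod]
      _ = q * (t / q * p) + p * (t % q) := by ring
      _ ≤ q * (t / q * p + k) + p * q := by nlinarith

theorem card_sq_le_two_mul_sum (D : Finset ℕ) (hD : ∀ d ∈ D, 0 < d) :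
    D.card * D.card ≤ 2 * ∑ d ∈ D, d := by
  have h : ∀ m (D : Finset ℕ), D.card = m → (∀ d ∈ D, 0 < d) → m * m ≤ 2 * ∑ d ∈ D, d := by
    intro m
    induction m with
    | zero => simp
    | succ m ih =>
      intro D hm hD
      have hne : D.Nonempty := Finset.card_pos.mp (by omega)
      set b := D.max' hne
      have hb : b ∈ D := D.max'_mem hne
      have h1 := ih (D.erase b) (by rw [Finset.card_erase_of_mem hb, hm]; rfl)
        fun d hd => hD d (Finset.mem_of_mem_erase hd)
      have h2 : D ⊆ Finset.Icc 1 b := fun d hd =>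
        Finset.mem_Icc.mpr ⟨hD d hd, D.le_max' d hd⟩
      have h3 := Finset.card_le_card h2
      rw [hm, Nat.card_Icc, Nat.add_sub_cancel] at h3
      have h4 := Finset.add_sum_erase D (fun d => d) hb
      rw [← h4]
      nlinarith
  exact h _ D rfl hD

/-- There is a common multiple, not larger than `N ^ √(2 N)`, of lengths of critical closed
walks, one for each component of the critical graph: the lengths are bounded by the
sizes of the disjoint components, so at most `√(2 N)` of them are different. -/
theorem exists_common_period {p q : ℕ} (hm : IsMaxMean E p q) :
    ∃ R r : ℕ, 1 ≤ R ∧ r * r ≤ 2 * Fintype.card Q ∧ R ≤ Fintype.card Q ^ r ∧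
      ∀ u, IsCritical E p q u → ∃ x c k, Linked E p q u x ∧ 0 < c ∧ c ≤ Fintype.card Q ∧
        Walk E x x c k ∧ q * k = p * c ∧ c ∣ R := by
  classical
  let comps : Finset (Finset Q) :=
    (Finset.univ.filter (IsCritical E p q)).image (linkedSet E p q)
  have hS : ∀ S : Finset Q, ∃ c : ℕ, S ∈ comps → 0 < c ∧ c ≤ S.card ∧
      ∃ x k, x ∈ S ∧ Walk E x x c k ∧ q * k = p * c := by
    intro S
    by_cases h : S ∈ comps
    · obtain ⟨u, hu, rfl⟩ := Finset.mem_image.mp h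
      obtain ⟨x, c, k, hx, h0, h1, h2, h3⟩ :=
        exists_short_critical hm (Finset.mem_filter.mp hu).2
      exact ⟨c, fun _ => ⟨h0, h1, x, k, mem_linkedSet.2 hx, h2, h3⟩⟩
    · exact ⟨0, fun h' => absurd h' h⟩
  choose c hc using hS
  have hdisj : (comps : Set (Finset Q)).PairwiseDisjoint id := by
    intro S hS T hT hne
    obtain ⟨u, -, rfl⟩ := Finset.mem_image.mp hS
    obtain ⟨v, -, rfl⟩ := Finset.mem_image.mp hT
    refine Finset.disjoint_left.mpr fun x hx hx' => hne ?_
    have hx : Linked E p q u x := mem_linkedSet.1 hx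
    have hx' : Linked E p q v x := mem_linkedSet.1 hx'
    have huv : Linked E p q u v := hx.trans hx'.symm
    ext y
    rw [mem_linkedSet, mem_linkedSet]
    exact ⟨fun h => huv.symm.trans h, fun h => huv.trans h⟩
  have hcle : ∀ S, S ∈ comps → c S ≤ Fintype.card Q := fun S hS =>
    (hc S hS).2.1.trans (Finset.card_le_univ S)
  have hpos : ∀ d ∈ comps.image c, 0 < d := by
    intro d hd
    obtain ⟨S, hS, rfl⟩ := Finset.mem_image.mp hd
    exact (hc S hS).1
  have hsum : ∑ d ∈ comps.image c, d ≤ Fintype.card Q := by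
    calc ∑ d ∈ comps.image c, d ≤ ∑ S ∈ comps, c S :=
          Finset.sum_image_le_of_nonneg (fun _ _ => Nat.zero_le _)
      _ ≤ ∑ S ∈ comps, S.card := Finset.sum_le_sum fun S hS => (hc S hS).2.1
      _ = (comps.biUnion id).card := (Finset.card_biUnion hdisj).symm
      _ ≤ Fintype.card Q := Finset.card_le_univ _
  refine ⟨∏ d ∈ comps.image c, d, (comps.image c).card, Finset.prod_pos hpos,
    (card_sq_le_two_mul_sum _ hpos).trans (by omega), ?_, ?_⟩
  · refine Finset.prod_le_pow_card _ _ _ fun d hd => ?_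
    obtain ⟨S, hS, rfl⟩ := Finset.mem_image.mp hd
    exact hcle S hS
  · intro u hu
    have hS : linkedSet E p q u ∈ comps :=
      Finset.mem_image_of_mem _ (Finset.mem_filter.mpr ⟨Finset.mem_univ u, hu⟩)
    obtain ⟨h0, h1, x, k, hx, hw, hk⟩ := hc _ hS
    exact ⟨x, _, k, mem_linkedSet.1 hx, h0, hcle _ hS, hw, hk,
      Finset.dvd_prod_of_mem _ (Finset.mem_image_of_mem c hS)⟩

/-- `d t` is the maximal value of walks of length `t`, where the value of a walk is the sum of its
weight and of a number `g u` which depends on its starting point `u`. -/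
structure IsMaxWeight (E : Q → Q → ℕ → Prop) (g : Q → ℕ) (d : ℕ → ℕ) : Prop where
  le : ∀ u v t k, Walk E u v t k → g u + k ≤ d t
  attained : ∀ t, ∃ u v k, Walk E u v t k ∧ d t ≤ g u + k

namespace IsMaxWeight

variable {g : Q → ℕ} {d : ℕ → ℕ} {p q n : ℕ}

theorem lower (hd : IsMaxWeight E g d) (hm : IsMaxMean E p q) (hE : ∀ u, ∃ v b, E u v b) (t : ℕ) :
    p * t ≤ q * d t + p * q := by
  obtain ⟨u, v, k, hw, hk⟩ := hm.exists_walk hE t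
  have := Nat.mul_le_mul_left q ((Nat.le_add_left _ _).trans (hd.le _ _ _ _ hw))
  omega

theorem upper (hd : IsMaxWeight E g d) (hm : IsMaxMean E p q) (hb : ∀ u v b, E u v b → b ≤ 1)
    (hg : ∀ u, g u ≤ n) (t : ℕ) :
    q * d t ≤ p * t + q * (n + Fintype.card Q) := by
  obtain ⟨u, v, k, hw, hk⟩ := hd.attained t
  have h1 := hw.weight_le_of_isMaxMean hm hb
  have h2 : q * d t ≤ q * (n + k) := Nat.mul_le_mul_left q (hk.trans (by have := hg u; omega))
  nlinarith

/-- For large `t`, a walk of maximal value passes through a critical vertex, and thus can be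
replaced by walks of all large lengths `t'` in a residue class. -/
theorem extend (hd : IsMaxWeight E g d) (hm : IsMaxMean E p q) (hE : ∀ u, ∃ v b, E u v b)
    (hb : ∀ u v b, E u v b → b ≤ 1) (hg : ∀ u, g u ≤ n) {R : ℕ}
    (hR : ∀ u, IsCritical E p q u → ∃ x c k, Linked E p q u x ∧ 0 < c ∧ c ≤ Fintype.card Q ∧
        Walk E x x c k ∧ q * k = p * c ∧ c ∣ R) {t t' : ℕ}
    (ht : Fintype.card Q ^ 2 * (Fintype.card Q + n) + Fintype.card Q < t)
    (ht' : 2 * Fintype.card Q ^ 2 ≤ t') (hmod : t' ≡ t [MOD R]) :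
    q * d t + p * t' ≤ q * d t' + p * t := by
  obtain ⟨u, v, k, hw, hk⟩ := hd.attained t
  set N := Fintype.card Q with hN
  rcases hw.critical_or_avoids (p := p) (q := q) with
    ⟨w, l₁, k₁, l₂, k₂, hcr, h1, h2, h3, h4⟩ | hav
  · obtain ⟨x, c, kc, hx, hc0, hcN, hcx, hkc, hcR⟩ := hR w hcr
    have hcN' : 2 * (c * N) ≤ t' := by nlinarith
    obtain ⟨k', hw', hk'⟩ := exists_walk_modEq hm hc0 h1 h2 hx hcx hkc hcN'
      (h3 ▸ hmod.of_dvd hcR)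
    have h5 := Nat.mul_le_mul_left q (hd.le _ _ _ _ hw')
    have h6 := Nat.mul_le_mul_left q hk
    subst h3 h4
    nlinarith
  · exfalso
    have h1 := hav.weight_le_of_avoids hm hb
    rw [← hN] at h1
    have h2 := hd.lower hm hE t
    have h3 : q * d t ≤ q * (n + k) := Nat.mul_le_mul_left q (hk.trans (by have := hg u; omega))
    have h4 : N * (p * t) ≤ N * (q * (n + k) + p * q) := Nat.mul_le_mul_left _ (by omega)
    have hqN : q ≤ N := hm.le_card
    have h5 : N * (p * q) ≤ N * (p * N) := by gcongr
    have h6 : N * (q * n) ≤ N * (N * n) := by gcongr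
    have h7 : N * (q * N) ≤ N * (N * N) := by gcongr
    nlinarith

theorem add_period (hd : IsMaxWeight E g d) (hm : IsMaxMean E p q) (hE : ∀ u, ∃ v b, E u v b)
    (hb : ∀ u v b, E u v b → b ≤ 1) (hg : ∀ u, g u ≤ n) {R : ℕ}
    (hR : ∀ u, IsCritical E p q u → ∃ x c k, Linked E p q u x ∧ 0 < c ∧ c ≤ Fintype.card Q ∧
        Walk E x x c k ∧ q * k = p * c ∧ c ∣ R) {t : ℕ}
    (ht : Fintype.card Q ^ 2 * (Fintype.card Q + n) + Fintype.card Q < t)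
    (ht' : 2 * Fintype.card Q ^ 2 ≤ t) :
    q * d (t + R) = q * d t + p * R := by
  have h1 := hd.extend hm hE hb hg hR (t := t) (t' := t + R) ht (by omega) (by simp [Nat.ModEq])
  have h2 := hd.extend hm hE hb hg hR (t := t + R) (t' := t) (by omega) ht' (by simp [Nat.ModEq])
  rw [mul_add] at h1 h2
  omega

end IsMaxWeight

end

/-! ### The dimension of the set of tropical recurrent sequences -/

/-- The vectors `x` and `x'` satisfy the same inequalities `m ≤ x i - x j`, for indices `i, j` in
`A` and integers `m`. -/
def SameOn {ι : Type*} (A : Set ι) (x x' : ι → ℝ) : Prop :=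
  ∀ i ∈ A, ∀ j ∈ A, ∀ m : ℤ, (m : ℝ) ≤ x i - x j ↔ (m : ℝ) ≤ x' i - x' j

namespace SameOn

variable {ι : Type*} {A : Set ι} {x x' x'' : ι → ℝ}

theorem refl (A : Set ι) (x : ι → ℝ) : SameOn A x x := fun _ _ _ _ _ => Iff.rfl

theorem symm (h : SameOn A x x') : SameOn A x' x := fun i hi j hj m => (h i hi j hj m).symm

theorem trans (h : SameOn A x x') (h' : SameOn A x' x'') : SameOn A x x'' :=
  fun i hi j hj m => (h i hi j hj m).trans (h' i hi j hj m)

theorem mono {B : Set ι} (h : SameOn A x x') (hB : B ⊆ A) : SameOn B x x' :=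
  fun i hi j hj => h i (hB hi) j (hB hj)

theorem sub_le_iff (h : SameOn A x x') {i j : ι} (hi : i ∈ A) (hj : j ∈ A) (m : ℤ) :
    x i - x j ≤ m ↔ x' i - x' j ≤ m := by
  have := h j hj i hi (-m)
  push_cast at this
  constructor <;> intro h1
  · linarith [this.1 (by linarith)]
  · linarith [this.2 (by linarith)]

theorem le_iff (h : SameOn A x x') {i j : ι} (hi : i ∈ A) (hj : j ∈ A) : x i ≤ x j ↔ x' i ≤ x' j := by
  have := h.sub_le_iff hi hj 0
  simpa using this

theorem add_le_add_iff (h : SameOn A x x') {i j : ι} (hi : i ∈ A) (hj : j ∈ A) (a b : ℤ) :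
    x i + a ≤ x j + b ↔ x' i + a ≤ x' j + b := by
  have := h.sub_le_iff hi hj (b - a)
  push_cast at this
  constructor <;> intro h1
  · linarith [this.1 (by linarith)]
  · linarith [this.2 (by linarith)]

end SameOn

/-- The number of classes of the numbers `y i` modulo integers. -/
noncomputable def numClasses {ι : Type*} [Fintype ι] (y : ι → ℝ) : ℕ :=
  (Finset.univ.image fun i => Int.fract (y i)).card

theorem numClasses_le {ι : Type*} [Fintype ι] (y : ι → ℝ) : numClasses y ≤ Fintype.card ι :=
  Finset.card_image_le

/-- The vectors that are constant on the classes of the numbers `y i` modulo integers. -/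
def classSubmodule {ι : Type*} (y : ι → ℝ) : Submodule ℝ (ι → ℝ) where
  carrier := {v | ∀ i j, Int.fract (y i) = Int.fract (y j) → v i = v j}
  add_mem' {v w} hv hw i j h := by simp [hv i j h, hw i j h]
  zero_mem' _ _ _ := rfl
  smul_mem' c v hv i j h := by simp [hv i j h]

theorem finrank_classSubmodule {ι : Type*} [Fintype ι] (y : ι → ℝ) :
    Module.finrank ℝ (classSubmodule y) = numClasses y := by
  classical
  let T : Finset ℝ := Finset.univ.image fun i => Int.fract (y i)
  let f : ι → T := fun i => ⟨Int.fract (y i), Finset.mem_image_of_mem _ (Finset.mem_univ i)⟩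
  have hf : Function.Surjective f := by
    rintro ⟨z, hz⟩
    obtain ⟨i, -, rfl⟩ := Finset.mem_image.mp hz
    exact ⟨i, rfl⟩
  have hrange : LinearMap.range (LinearMap.funLeft ℝ ℝ f) = classSubmodule y := by
    ext v
    constructor
    · rintro ⟨c, rfl⟩ i j h
      have : f i = f j := Subtype.ext h
      simp [LinearMap.funLeft_apply, this]
    · intro hv
      refine ⟨fun z => v (hf z).choose, funext fun i => ?_⟩
      rw [LinearMap.funLeft_apply]
      exact hv _ _ (congrArg Subtype.val (hf (f i)).choose_spec)
  rw [← hrange, LinearMap.finrank_range_of_inj (LinearMap.funLeft_injective_of_surjective ℝ ℝ f hf)]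
  simp [T, numClasses]

theorem fract_eq_of_sub_eq {u v : ℝ} {m : ℤ} (h : u - v = m) : Int.fract u = Int.fract v :=
  Int.fract_eq_fract.mpr ⟨m, h⟩

/-- A number that is not an integer keeps its floor and remains not an integer under a small
perturbation. -/
theorem eventually_floor_perturb {d : ℝ} (hd : ∀ m : ℤ, d ≠ m) (e : ℝ) :
    ∀ᶠ ε : ℝ in 𝓝 0, (∀ m : ℤ, (m : ℝ) ≤ d + ε * e ↔ (m : ℝ) ≤ d) ∧ ∀ m : ℤ, d + ε * e ≠ m := by
  have h1 : d ∈ Set.Ioo (⌊d⌋ : ℝ) (⌊d⌋ + 1) :=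
    ⟨lt_of_le_of_ne (Int.floor_le d) (hd _).symm, Int.lt_floor_add_one d⟩
  have h2 : Tendsto (fun ε : ℝ => d + ε * e) (𝓝 0) (𝓝 d) := by
    have : Continuous fun ε : ℝ => d + ε * e := by fun_prop
    simpa using this.tendsto 0
  filter_upwards [h2.eventually (Ioo_mem_nhds h1.1 h1.2)] with ε hε
  have h3 : ⌊d + ε * e⌋ = ⌊d⌋ := Int.floor_eq_iff.mpr ⟨hε.1.le, hε.2⟩
  refine ⟨fun m => by rw [← Int.le_floor, h3, Int.le_floor], fun m hm => ?_⟩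
  rw [hm, Int.floor_intCast] at h3
  rw [hm, ← h3] at hε
  exact lt_irrefl _ hε.1

theorem sub_ne_intCast_of_fract_ne {u v : ℝ} (h : Int.fract u ≠ Int.fract v) (m : ℤ) :
    u - v ≠ m := fun h' => h (fract_eq_of_sub_eq h')

theorem convex_sameOn {ι : Type*} (y : ι → ℝ) : Convex ℝ {x | SameOn Set.univ y x} := by
  have : {x : ι → ℝ | SameOn Set.univ y x} =
      ⋂ i, ⋂ j, ⋂ m : ℤ, {x | (m : ℝ) ≤ y i - y j ↔ (m : ℝ) ≤ x i - x j} := by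
    ext x
    simp [SameOn]
  rw [this]
  refine convex_iInter fun i => convex_iInter fun j => convex_iInter fun m => ?_
  have hl : IsLinearMap ℝ fun x : ι → ℝ => x i - x j :=
    ⟨fun x x' => by simp only [Pi.add_apply]; ring, fun c x => by
      simp only [Pi.smul_apply, smul_eq_mul]; ring⟩
  by_cases h : (m : ℝ) ≤ y i - y j
  · simpa only [h, true_iff] using convex_halfSpace_ge hl (m : ℝ)
  · simpa only [h, false_iff, not_le] using convex_halfSpace_lt hl (m : ℝ)

/-- The vectors that satisfy the same inequalities as `y` form a set of at least the dimension
`numClasses y`: the classes of coordinates modulo integers can be shifted independently. -/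
theorem classSubmodule_le_vectorSpan {ι : Type*} [Finite ι] (y : ι → ℝ) :
    classSubmodule y ≤ vectorSpan ℝ {x | SameOn Set.univ y x} := by
  intro v hv
  have h : ∀ᶠ ε : ℝ in 𝓝 0, ∀ i j, ∀ m : ℤ,
      (m : ℝ) ≤ y i - y j ↔ (m : ℝ) ≤ (y + ε • v) i - (y + ε • v) j := by
    refine eventually_all.mpr fun i => eventually_all.mpr fun j => ?_
    by_cases hij : Int.fract (y i) = Int.fract (y j)
    · refine Eventually.of_forall fun ε m => ?_
      simp [hv i j hij]
    · filter_upwards [eventually_floor_perturb (sub_ne_intCast_of_fract_ne hij) (v i - v j)]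
        with ε hε m
      rw [← hε.1 m]
      simp only [Pi.add_apply, Pi.smul_apply, smul_eq_mul]
      ring_nf
  obtain ⟨ε, hε, hε0⟩ :=
    ((h.filter_mono nhdsWithin_le_nhds).and (self_mem_nhdsWithin (s := {(0 : ℝ)}ᶜ))).exists
  have hε0 : ε ≠ 0 := hε0
  have h1 : (y + ε • v) -ᵥ y ∈ vectorSpan ℝ {x | SameOn Set.univ y x} :=
    vsub_mem_vectorSpan ℝ (fun i _ j _ m => hε i j m) (SameOn.refl _ _)
  have h2 : v = ε⁻¹ • ((y + ε • v) -ᵥ y) := by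
    simp [smul_smul, hε0]
  rw [h2]
  exact Submodule.smul_mem _ _ h1

/-- At a point `y` of a convex set `C` at which the number of pairs with an integer difference
`y i - y j` is minimal, these differences are constant on `C`. -/
theorem exists_vectorSpan_le_classSubmodule {ι : Type*} [Fintype ι] {C : Set (ι → ℝ)}
    (hC : Convex ℝ C) (hne : C.Nonempty) : ∃ y ∈ C, vectorSpan ℝ C ≤ classSubmodule y := by
  classical
  let pairs : (ι → ℝ) → Finset (ι × ι) := fun y =>
    Finset.univ.filter fun z => Int.fract (y z.1) = Int.fract (y z.2)
  obtain ⟨y, hy, hmin⟩ : ∃ y ∈ C, ∀ c ∈ C, (pairs y).card ≤ (pairs c).card :=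
    ⟨_, Function.argminOn_mem (fun y => (pairs y).card) C hne, fun c hc =>
      Function.argminOn_le (fun y => (pairs y).card) C hc⟩
  refine ⟨y, hy, ?_⟩
  have key : ∀ c ∈ C, ∀ i j, Int.fract (y i) = Int.fract (y j) → c i - c j = y i - y j := by
    intro c hc i j hij
    by_contra hne
    let e : ι → ℝ := c - y
    have h1 : ∀ᶠ ε : ℝ in 𝓝 0, ∀ i j, Int.fract (y i) ≠ Int.fract (y j) →
        Int.fract ((y + ε • e) i) ≠ Int.fract ((y + ε • e) j) := by
      refine eventually_all.mpr fun i => eventually_all.mpr fun j => ?_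
      by_cases hij : Int.fract (y i) = Int.fract (y j)
      · exact Eventually.of_forall fun _ h => absurd hij h
      · filter_upwards [eventually_floor_perturb (sub_ne_intCast_of_fract_ne hij) (e i - e j)]
          with ε hε _ heq
        obtain ⟨m, hm⟩ := Int.fract_eq_fract.mp heq
        refine hε.2 m ?_
        rw [← hm]
        simp only [Pi.add_apply, Pi.smul_apply, smul_eq_mul]
        ring
    have h2 : ∀ᶠ ε : ℝ in 𝓝 0, |ε * (e i - e j)| < 1 := by
      have : Continuous fun ε : ℝ => |ε * (e i - e j)| := by fun_prop
      have := this.tendsto 0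
      simp only [zero_mul, abs_zero] at this
      exact this.eventually (gt_mem_nhds one_pos)
    have h3 : ∀ᶠ ε : ℝ in 𝓝[>] 0, ε < 1 := nhdsWithin_le_nhds (gt_mem_nhds one_pos)
    obtain ⟨ε, ⟨⟨h1, h2⟩, h3⟩, h0⟩ := ((((h1.and h2).filter_mono nhdsWithin_le_nhds).and h3).and
      (self_mem_nhdsWithin (s := Set.Ioi (0 : ℝ)))).exists
    have h0 : 0 < ε := h0
    have hmem : y + ε • e ∈ C := hC.add_smul_sub_mem hy hc ⟨h0.le, h3.le⟩
    have hlt : pairs (y + ε • e) ⊂ pairs y := by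
      refine (Finset.ssubset_iff_of_subset fun z hz => ?_).mpr ⟨(i, j), by simpa [pairs] using hij, ?_⟩
      · simp only [pairs, Finset.mem_filter, Finset.mem_univ, true_and] at hz ⊢
        by_contra h
        exact h1 _ _ h hz
      · simp only [pairs, Finset.mem_filter, Finset.mem_univ, true_and]
        intro heq
        obtain ⟨m, hm⟩ := Int.fract_eq_fract.mp heq
        obtain ⟨m', hm'⟩ := Int.fract_eq_fract.mp hij
        have h4 : ε * (e i - e j) = ((m - m' : ℤ) : ℝ) := by
          push_cast
          rw [← hm, ← hm']
          simp only [Pi.add_apply, Pi.smul_apply, smul_eq_mul]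
          ring
        rw [h4, ← Int.cast_abs] at h2
        have h5 : m - m' = 0 := Int.abs_lt_one_iff.mp (by exact_mod_cast h2)
        rw [h5, Int.cast_zero, mul_eq_zero] at h4
        rcases h4 with h4 | h4
        · exact h0.ne' h4
        · refine hne ?_
          simp only [e, Pi.sub_apply] at h4
          linarith
    exact absurd (hmin _ hmem) (not_le.mpr (Finset.card_lt_card hlt))
  rw [vectorSpan, Submodule.span_le]
  rintro _ ⟨c, hc, c', hc', rfl⟩ i j hij
  have h1 := key c hc i j hij
  have h2 := key c' hc' i j hij
  simp only [vsub_eq_sub, Pi.sub_apply]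
  linarith

theorem le_polyhedralDim {s : ℕ} {X C : Set (Fin s → ℝ)} (hC : Convex ℝ C) (hX : C ⊆ X) :
    Module.finrank ℝ (affineSpan ℝ C).direction ≤ polyhedralDim X := by
  refine le_csSup ⟨s, ?_⟩ ⟨C, hC, hX, rfl⟩
  rintro k ⟨C, -, -, rfl⟩
  simpa using Submodule.finrank_le (affineSpan ℝ C).direction

section

variable {n : ℕ} (a : Fin (n + 1) → ℤ)

theorem MinAttainedTwice.congr {b b' : Fin (n + 1) → ℝ} (h : MinAttainedTwice b)
    (hb : ∀ i j, b i ≤ b j → b' i ≤ b' j) : MinAttainedTwice b' := by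
  obtain ⟨i₁, i₂, hne, h1, h2⟩ := h
  exact ⟨i₁, i₂, hne, fun k => hb _ _ (h1 k), fun k => hb _ _ (h2 k)⟩

theorem numClasses_le_tropicalHilbert {s : ℕ} {y : Fin s → ℝ} (hy : y ∈ tropicalRecurrent a s) :
    numClasses y ≤ tropicalHilbert a s := by
  refine le_trans ?_ (le_polyhedralDim (convex_sameOn y) fun x hx j hj =>
    (hy j hj).congr fun i k => (hx.add_le_add_iff (Set.mem_univ _) (Set.mem_univ _) _ _).1)
  rw [direction_affineSpan, ← finrank_classSubmodule]
  exact Submodule.finrank_mono (classSubmodule_le_vectorSpan y)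

theorem exists_tropicalHilbert_le {s : ℕ} (hne : (tropicalRecurrent a s).Nonempty) :
    ∃ y ∈ tropicalRecurrent a s, tropicalHilbert a s ≤ numClasses y := by
  have hmem : tropicalHilbert a s ∈ {k : ℕ | ∃ C : Set (Fin s → ℝ), Convex ℝ C ∧
      C ⊆ tropicalRecurrent a s ∧ k = Module.finrank ℝ (affineSpan ℝ C).direction} := by
    refine Nat.sSup_mem ⟨_, ∅, convex_empty, Set.empty_subset _, rfl⟩ ⟨s, ?_⟩
    rintro k ⟨C, -, -, rfl⟩
    simpa using Submodule.finrank_le (affineSpan ℝ C).direction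
  obtain ⟨C, hC, hsub, hk⟩ := hmem
  rcases C.eq_empty_or_nonempty with rfl | hCne
  · obtain ⟨y, hy⟩ := hne
    refine ⟨y, hy, ?_⟩
    rw [hk, direction_affineSpan, vectorSpan_empty, finrank_bot]
    exact Nat.zero_le _
  · obtain ⟨y, hy, hle⟩ := exists_vectorSpan_le_classSubmodule hC hCne
    refine ⟨y, hsub hy, ?_⟩
    rw [hk, direction_affineSpan, ← finrank_classSubmodule]
    exact Submodule.finrank_mono hle

end

/-! ### Types of windows -/

section

variable {n M : ℕ}

/-- The coordinates of a window that are not too large compared with the other coordinates. Only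
these coordinates can influence the minima in which they take part as long as they stay in
the window. -/
def IsBdd (M : ℕ) (x : Fin n → ℝ) (i : Fin n) : Prop :=
  ∀ j, x i - x j ≤ (((i : ℕ) : ℝ) + 1) * M

theorem IsBdd.of_min {x : Fin n → ℝ} {p : Fin n} (hp : ∀ j, x p ≤ x j) : IsBdd M x p := fun j => by
  have h1 : (0 : ℝ) ≤ (((p : ℕ) : ℝ) + 1) * M := by positivity
  linarith [hp j]

theorem isBdd_iff_of_min {x : Fin n → ℝ} {p : Fin n} (hp : ∀ j, x p ≤ x j) (i : Fin n) :
    IsBdd M x i ↔ x i - x p ≤ ((((i : ℕ) + 1) * M : ℤ) : ℝ) := by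
  push_cast
  exact ⟨fun h => h p, fun h j => by linarith [hp j]⟩

/-- Two windows have the same type if they have the same bounded coordinates, and the differences
of these coordinates have the same floors. -/
def windowSetoid (n M : ℕ) : Setoid (Fin n → ℝ) where
  r x x' := (∀ i, IsBdd M x i ↔ IsBdd M x' i) ∧ SameOn {i | IsBdd M x i} x x'
  iseqv :=
    { refl := fun _ => ⟨fun _ => Iff.rfl, SameOn.refl _ _⟩
      symm := fun h => ⟨fun i => (h.1 i).symm, h.2.symm.mono fun i hi => (h.1 i).2 hi⟩
      trans := fun h h' => ⟨fun i => (h.1 i).trans (h'.1 i),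
        h.2.trans (h'.2.mono fun i hi => (h.1 i).1 hi)⟩ }

/-- The type of a window. -/
abbrev WindowType (n M : ℕ) : Type := Quotient (windowSetoid n M)

/-- The type of the window `x`. -/
def windowType (M : ℕ) (x : Fin n → ℝ) : WindowType n M := Quotient.mk (windowSetoid n M) x

theorem windowType_eq_iff {x x' : Fin n → ℝ} : windowType M x = windowType M x' ↔
    (∀ i, IsBdd M x i ↔ IsBdd M x' i) ∧ SameOn {i | IsBdd M x i} x x' :=
  Quotient.eq (r := windowSetoid n M)

theorem windowType_eq_of_sameOn {A : Set (Fin n)} {x x' : Fin n → ℝ} (hA : ∀ i, IsBdd M x i → i ∈ A)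
    (hA' : ∀ i, IsBdd M x' i → i ∈ A) (h : SameOn A x x') : windowType M x = windowType M x' := by
  refine windowType_eq_iff.2 ⟨fun i => ?_, h.mono hA⟩
  have : Nonempty (Fin n) := ⟨i⟩
  obtain ⟨p, hp⟩ := Finite.exists_min x
  obtain ⟨p', hp'⟩ := Finite.exists_min x'
  have hpA : p ∈ A := hA p (.of_min hp)
  have hp2 : ∀ j, x' p ≤ x' j := fun j =>
    ((h.le_iff hpA (hA' p' (.of_min hp'))).1 (hp p')).trans (hp' j)
  by_cases hi : i ∈ A
  · rw [isBdd_iff_of_min hp, isBdd_iff_of_min hp2, h.sub_le_iff hi hpA]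
  · exact iff_of_false (fun h => hi (hA i h)) fun h => hi (hA' i h)

theorem min_of_windowType_eq {x x' : Fin n → ℝ} (h : windowType M x = windowType M x') {p : Fin n}
    (hp : ∀ j, x p ≤ x j) (j : Fin n) : x' p ≤ x' j := by
  have : Nonempty (Fin n) := ⟨p⟩
  obtain ⟨hb, hs⟩ := windowType_eq_iff.1 h
  obtain ⟨p', hp'⟩ := Finite.exists_min x'
  exact ((hs.le_iff (.of_min hp) ((hb p').2 (.of_min hp'))).1 (hp p')).trans (hp' j)

/-! ### Transitions between types -/

/-- The indices of the bounded coordinates of a window `x` and of the coordinate that follows. -/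
def extBdd (M : ℕ) (x : Fin n → ℝ) : Set (Fin (n + 1)) :=
  {i | ∀ k : Fin n, i = k.castSucc → IsBdd M x k}

theorem last_mem_extBdd (x : Fin n → ℝ) : Fin.last n ∈ extBdd M x := fun k hk =>
  absurd hk (Fin.castSucc_lt_last k).ne'

theorem castSucc_mem_extBdd {x : Fin n → ℝ} {k : Fin n} :
    k.castSucc ∈ extBdd M x ↔ IsBdd M x k :=
  ⟨fun h => h k rfl, fun h _ hk => Fin.castSucc_injective _ hk ▸ h⟩

variable {a : Fin (n + 1) → ℤ}

theorem amplitude_cast (ha : ∀ i k, a i - a k ≤ (M : ℤ)) (i k : Fin (n + 1)) : (a i : ℝ) - a k ≤ M := by exact_mod_cast ha i k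

theorem le_succ_mul (j M : ℕ) : (M : ℝ) ≤ ((j : ℝ) + 1) * M := by
  have : (0 : ℝ) ≤ (j : ℝ) * M := by positivity
  linarith

/-- The minimum over a window and the following coordinate is not attained at an unbounded
coordinate. -/
theorem mem_extBdd_of_min (ha : ∀ i k, a i - a k ≤ (M : ℤ)) {X : Fin (n + 1) → ℝ}
    {i : Fin (n + 1)} (hi : ∀ k, X i + a i ≤ X k + a k) : i ∈ extBdd M (X ∘ Fin.castSucc) := by
  rintro k rfl j
  have h1 := hi j.castSucc
  have h2 := amplitude_cast ha j.castSucc k.castSucc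
  have h3 := le_succ_mul k M
  simp only [Function.comp_apply]
  linarith

theorem MinAttainedTwice.of_sameOn (ha : ∀ i k, a i - a k ≤ (M : ℤ)) {X X' : Fin (n + 1) → ℝ}
    (hb : ∀ i, IsBdd M (X ∘ Fin.castSucc) i ↔ IsBdd M (X' ∘ Fin.castSucc) i)
    (h : SameOn (extBdd M (X ∘ Fin.castSucc)) X X')
    (hX : MinAttainedTwice fun i => X i + a i) : MinAttainedTwice fun i => X' i + a i := by
  obtain ⟨i₁, i₂, hne, h1, h2⟩ := hX
  have key : ∀ i, (∀ k, X i + a i ≤ X k + a k) → ∀ k, X' i + a i ≤ X' k + a k := by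
    intro i hi
    have hiA := mem_extBdd_of_min ha hi
    have hA : ∀ k ∈ extBdd M (X ∘ Fin.castSucc), X' i + a i ≤ X' k + a k := fun k hk =>
      (h.add_le_add_iff hiA hk _ _).1 (hi k)
    intro k
    by_cases hk : k ∈ extBdd M (X ∘ Fin.castSucc)
    · exact hA k hk
    -- An unbounded coordinate of `X'` exceeds the minimal one by more than the amplitude.
    obtain ⟨k, rfl⟩ : ∃ k' : Fin n, k = k'.castSucc := by
      refine ⟨k.castPred fun h => hk (h ▸ last_mem_extBdd _), (Fin.castSucc_castPred _ _).symm⟩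
    rw [castSucc_mem_extBdd, hb] at hk
    simp only [IsBdd, not_forall, not_le] at hk
    obtain ⟨j, hj⟩ := hk
    have : Nonempty (Fin n) := ⟨k⟩
    obtain ⟨p, hp⟩ := Finite.exists_min (X' ∘ Fin.castSucc)
    have h3 := hA p.castSucc (castSucc_mem_extBdd.2 ((hb p).2 (.of_min hp)))
    have h4 := hp j
    have h5 := amplitude_cast ha p.castSucc k.castSucc
    have h6 := le_succ_mul k M
    simp only [Function.comp_apply] at hj h4
    linarith
  exact ⟨i₁, i₂, hne, key i₁ h1, key i₂ h2⟩

/-- A coordinate that is unbounded in a window remains so in the next window: its index decreases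
by `1`, and the minimum increases by at most `M`. -/
theorem succ_mem_extBdd (ha : ∀ i k, a i - a k ≤ (M : ℤ)) {X : Fin (n + 1) → ℝ}
    (hX : MinAttainedTwice fun i => X i + a i) {i : Fin n} (hi : IsBdd M (X ∘ Fin.succ) i) :
    i.succ ∈ extBdd M (X ∘ Fin.castSucc) := by
  intro k hk j
  have hik : ((k : ℕ) : ℝ) = (i : ℕ) + 1 := by
    have := congrArg Fin.val hk
    simp only [Fin.val_succ, Fin.val_castSucc] at this
    exact_mod_cast this.symm
  have hi' : ∀ l : Fin n, X k.castSucc - X l.succ ≤ (((i : ℕ) : ℝ) + 1) * M := fun l => by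
    rw [← hk]; exact hi l
  simp only [Function.comp_apply]
  rw [hik]
  have hM : (0 : ℝ) ≤ M := Nat.cast_nonneg M
  rcases Fin.eq_zero_or_eq_succ j.castSucc with h0 | ⟨l, hl⟩
  · obtain ⟨l, hl⟩ : ∃ l : Fin n, ∀ k, X l.succ + a l.succ ≤ X k + a k := by
      obtain ⟨i₁, i₂, hne, h1, h2⟩ := hX
      rcases Fin.eq_zero_or_eq_succ i₁ with h | ⟨l, rfl⟩
      · rcases Fin.eq_zero_or_eq_succ i₂ with h' | ⟨l, rfl⟩
        · exact absurd (h.trans h'.symm) hne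
        · exact ⟨l, h2⟩
      · exact ⟨l, h1⟩
    have h1 := hl 0
    have h2 := hi' l
    have h3 := amplitude_cast ha 0 l.succ
    rw [h0]
    linarith
  · rw [hl]
    linarith [hi' l]

theorem windowType_succ_eq (ha : ∀ i k, a i - a k ≤ (M : ℤ)) {X X' : Fin (n + 1) → ℝ}
    (hb : ∀ i, IsBdd M (X ∘ Fin.castSucc) i ↔ IsBdd M (X' ∘ Fin.castSucc) i)
    (h : SameOn (extBdd M (X ∘ Fin.castSucc)) X X')
    (hX : MinAttainedTwice fun i => X i + a i) :
    windowType M (X ∘ Fin.succ) = windowType M (X' ∘ Fin.succ) := by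
  have hX' := hX.of_sameOn ha hb h
  refine windowType_eq_of_sameOn (A := {i | i.succ ∈ extBdd M (X ∘ Fin.castSucc)})
    (fun i hi => succ_mem_extBdd ha hX hi) (fun i hi k hk => ?_)
    fun i hi j hj => h i.succ hi j.succ hj
  exact (hb k).2 (succ_mem_extBdd ha hX' hi k hk)

theorem le_iff_of_mem_Ioo {d d' : ℝ} {m : ℤ} (hd : d ∈ Set.Ioo (m : ℝ) (m + 1))
    (hd' : d' ∈ Set.Ioo (m : ℝ) (m + 1)) (k : ℤ) :
    ((k : ℝ) ≤ d ↔ (k : ℝ) ≤ d') ∧ ((k : ℝ) ≤ -d ↔ (k : ℝ) ≤ -d') := by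
  have h1 : ⌊d⌋ = m := Int.floor_eq_iff.mpr ⟨hd.1.le, hd.2⟩
  have h2 : ⌊d'⌋ = m := Int.floor_eq_iff.mpr ⟨hd'.1.le, hd'.2⟩
  have h3 : ⌈d⌉ = m + 1 := Int.ceil_eq_iff.mpr ⟨by push_cast; linarith [hd.1], by
    push_cast; exact hd.2.le⟩
  have h4 : ⌈d'⌉ = m + 1 := Int.ceil_eq_iff.mpr ⟨by push_cast; linarith [hd'.1], by
    push_cast; exact hd'.2.le⟩
  constructor
  · rw [← Int.le_floor, ← Int.le_floor, h1, h2]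
  · rw [← Int.le_floor, ← Int.le_floor, Int.floor_neg, Int.floor_neg, h3, h4]

theorem sameOn_extBdd {x : Fin n → ℝ} {X X' : Fin (n + 1) → ℝ} (hx : X ∘ Fin.castSucc = x)
    (h : SameOn {i | IsBdd M x i} x (X' ∘ Fin.castSucc))
    (h' : ∀ j, IsBdd M x j → ∀ m : ℤ,
      ((m : ℝ) ≤ X (Fin.last n) - x j ↔ (m : ℝ) ≤ X' (Fin.last n) - X' j.castSucc) ∧
      ((m : ℝ) ≤ -(X (Fin.last n) - x j) ↔ (m : ℝ) ≤ -(X' (Fin.last n) - X' j.castSucc))) :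
    SameOn (extBdd M x) X X' := by
  subst hx
  intro i
  refine Fin.lastCases ?_ (fun i => ?_) i
  · intro _ j
    refine Fin.lastCases ?_ (fun j => ?_) j
    · intro _ m
      simp
    · intro hj m
      exact (h' j (castSucc_mem_extBdd.1 hj) m).1
  · intro hi j
    refine Fin.lastCases ?_ (fun j => ?_) j
    · intro _ m
      have := (h' i (castSucc_mem_extBdd.1 hi) m).2
      simpa only [neg_sub, Function.comp_apply] using this
    · intro hj m
      exact h i (castSucc_mem_extBdd.1 hi) j (castSucc_mem_extBdd.1 hj) m

theorem countable_fract_mem (F : Finset ℝ) : {r : ℝ | Int.fract r ∈ F}.Countable := by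
  have : {r : ℝ | Int.fract r ∈ F} ⊆ ⋃ f ∈ F, Set.range fun m : ℤ => f + (m : ℝ) := by
    intro r hr
    exact Set.mem_biUnion hr ⟨⌊r⌋, Int.fract_add_floor r⟩
  exact (Set.Countable.biUnion F.countable_toSet fun f _ => Set.countable_range _).mono this

/-- A coordinate that follows a window can be transferred to another window of the same type. If it
is not congruent to a bounded coordinate modulo integers, then the classes in a finite set can
be avoided. -/
theorem exists_transfer {x : Fin n → ℝ} {X' : Fin (n + 1) → ℝ}
    (hx : windowType M x = windowType M (X' ∘ Fin.castSucc)) (F : Finset ℝ) :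
    ∃ r : ℝ, (∀ X : Fin (n + 1) → ℝ, X ∘ Fin.castSucc = x → X (Fin.last n) = r →
        SameOn (extBdd M x) X X') ∧
      ((∀ k, IsBdd M (X' ∘ Fin.castSucc) k →
        Int.fract (X' (Fin.last n)) ≠ Int.fract (X' k.castSucc)) → Int.fract r ∉ F) := by
  obtain ⟨hb, hs⟩ := windowType_eq_iff.1 hx
  set y' := X' (Fin.last n) with hy'
  by_cases hfr : ∀ k, IsBdd M (X' ∘ Fin.castSucc) k → Int.fract y' ≠ Int.fract (X' k.castSucc)
  · -- The possible values form an open set, which is not contained in a countable set.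
    let f : Fin n → ℤ := fun i => ⌊y' - X' i.castSucc⌋
    have hf : ∀ i, IsBdd M x i → y' - X' i.castSucc ∈ Set.Ioo (f i : ℝ) (f i + 1) := fun i hi =>
      ⟨lt_of_le_of_ne (Int.floor_le _)
        (sub_ne_intCast_of_fract_ne (hfr i ((hb i).1 hi)) _).symm, Int.lt_floor_add_one _⟩
    let O : Set ℝ := ⋂ i, ⋂ _ : IsBdd M x i, Set.Ioo (x i + f i) (x i + f i + 1)
    have hO : IsOpen O := isOpen_iInter_of_finite fun i =>
      isOpen_iInter_of_finite fun _ => isOpen_Ioo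
    have hne : O.Nonempty := by
      classical
      obtain ⟨r, hr1, hr2⟩ := Order.exists_between_finsets
        ((Finset.univ.filter (IsBdd M x)).image fun i => x i + f i)
        ((Finset.univ.filter (IsBdd M x)).image fun i => x i + f i + 1) (by
          intro u hu v hv
          obtain ⟨i, hi, rfl⟩ := Finset.mem_image.mp hu
          obtain ⟨k, hk, rfl⟩ := Finset.mem_image.mp hv
          replace hi : IsBdd M x i := (Finset.mem_filter.mp hi).2
          replace hk : IsBdd M x k := (Finset.mem_filter.mp hk).2
          by_contra! hlt
          have h1 := (hs i hi k hk (f k + 1 - f i)).1 (by push_cast; linarith)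
          push_cast at h1
          simp only [Function.comp_apply] at h1
          linarith [(hf i hi).1, (hf k hk).2])
      refine ⟨r, Set.mem_iInter.2 fun i => Set.mem_iInter.2 fun hi => ?_⟩
      have hi' := Finset.mem_filter.mpr ⟨Finset.mem_univ i, hi⟩
      exact ⟨hr1 _ (Finset.mem_image_of_mem _ hi'), hr2 _ (Finset.mem_image_of_mem _ hi')⟩
    obtain ⟨r, hrO, hrF⟩ := ((countable_fract_mem F).dense_compl ℝ).inter_open_nonempty O hO hne
    refine ⟨r, fun X hX hr => sameOn_extBdd hX hs fun j hj m => ?_, fun _ => hrF⟩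
    rw [hr]
    have h1 := Set.mem_iInter.1 (Set.mem_iInter.1 hrO j) hj
    exact le_iff_of_mem_Ioo ⟨by linarith [h1.1], by linarith [h1.2]⟩ (hf j hj) m
  · have hfr' := hfr
    push Not at hfr'
    obtain ⟨k, hk, heq⟩ := hfr'
    obtain ⟨m₀, hm₀⟩ := Int.fract_eq_fract.mp heq
    have hk' : IsBdd M x k := (hb k).2 hk
    refine ⟨x k + m₀, fun X hX hr => sameOn_extBdd hX hs fun j hj m => ?_, fun h => absurd h hfr⟩
    have h1 := hs k hk' j hj (m - m₀)
    have h2 := hs j hj k hk' (m + m₀)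
    push_cast at h1 h2
    simp only [Function.comp_apply] at h1 h2
    rw [hr, ← hy', show y' = X' k.castSucc + m₀ by linarith]
    refine ⟨⟨fun h3 => ?_, fun h3 => ?_⟩, ⟨fun h3 => ?_, fun h3 => ?_⟩⟩
    · linarith [h1.1 (by linarith)]
    · linarith [h1.2 (by linarith)]
    · linarith [h2.1 (by linarith)]
    · linarith [h2.2 (by linarith)]

/-- The weighted graph of types: an edge is given by a window and a following coordinate which
fulfil the recurrence. The weight may be `1` if this coordinate is not congruent to a bounded
coordinate modulo integers. -/
def TypeStep (a : Fin (n + 1) → ℤ) (M : ℕ) (u v : WindowType n M) (b : ℕ) : Prop :=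
  ∃ X : Fin (n + 1) → ℝ, (MinAttainedTwice fun i => X i + a i) ∧
    windowType M (X ∘ Fin.castSucc) = u ∧ windowType M (X ∘ Fin.succ) = v ∧
    (b = 0 ∨ b = 1 ∧ ∀ k, IsBdd M (X ∘ Fin.castSucc) k →
      Int.fract (X (Fin.last n)) ≠ Int.fract (X k.castSucc))

theorem TypeStep.weight_le {u v : WindowType n M} {b : ℕ} (h : TypeStep a M u v b) : b ≤ 1 := by
  obtain ⟨-, -, -, -, rfl | ⟨rfl, -⟩⟩ := h
  · exact zero_le_one
  · exact le_rfl

theorem TypeStep.exists (hn : 1 ≤ n) (u : WindowType n M) : ∃ v b, TypeStep a M u v b := by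
  obtain ⟨x, rfl⟩ := Quotient.exists_rep u
  have : Nonempty (Fin n) := ⟨⟨0, hn⟩⟩
  obtain ⟨p, hp⟩ := Finite.exists_min fun i : Fin n => x i + a i.castSucc
  let X : Fin (n + 1) → ℝ := Fin.snoc x (x p + a p.castSucc - a (Fin.last n))
  have hX1 : X ∘ Fin.castSucc = x := by
    ext i
    simp [X]
  have hX2 : X (Fin.last n) = x p + a p.castSucc - a (Fin.last n) := by simp [X]
  have hX3 : ∀ i : Fin n, X i.castSucc = x i := fun i => congrFun hX1 i
  have hmin : ∀ k, x p + a p.castSucc ≤ X k + a k := by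
    refine Fin.lastCases ?_ fun i => ?_
    · rw [hX2]; linarith
    · rw [hX3]; exact hp i
  refine ⟨_, 0, X, ⟨p.castSucc, Fin.last n, (Fin.castSucc_lt_last p).ne, fun k => ?_, fun k => ?_⟩,
    by rw [hX1]; rfl, rfl, .inl rfl⟩
  · simp only [hX3]
    exact hmin k
  · simp only [hX2]
    linarith [hmin k]

end

/-! ### Recurrent sequences as walks -/

section

variable {n M : ℕ} {a : Fin (n + 1) → ℤ}

/-- The sequence `y` fulfils the first `t` conditions of the recurrence. -/
def IsRecurrent (a : Fin (n + 1) → ℤ) (y : ℕ → ℝ) (t : ℕ) : Prop :=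
  ∀ j < t, MinAttainedTwice fun i : Fin (n + 1) => y (j + i) + a i

/-- The window of length `n` of a sequence that starts at `j`. -/
def window (n : ℕ) (y : ℕ → ℝ) (j : ℕ) : Fin n → ℝ := fun i => y (j + i)

theorem window_succ_comp_castSucc (y : ℕ → ℝ) (j : ℕ) :
    window (n + 1) y j ∘ Fin.castSucc = window n y j := rfl

theorem window_succ_comp_succ (y : ℕ → ℝ) (j : ℕ) :
    window (n + 1) y j ∘ Fin.succ = window n y (j + 1) := by
  ext i
  simp only [window, Function.comp_apply, Fin.val_succ]
  congr 1
  omega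

/-- The classes of the first `m` terms of a sequence modulo integers. -/
noncomputable def seqClasses (y : ℕ → ℝ) (m : ℕ) : Finset ℝ :=
  (Finset.range m).image fun i => Int.fract (y i)

theorem seqClasses_succ (y : ℕ → ℝ) (m : ℕ) :
    seqClasses y (m + 1) = insert (Int.fract (y m)) (seqClasses y m) := by
  rw [seqClasses, Finset.range_add_one, Finset.image_insert, seqClasses]

theorem numClasses_window (y : ℕ → ℝ) (m : ℕ) :
    numClasses (window m y 0) = (seqClasses y m).card := by
  rw [numClasses, seqClasses]
  congr 1
  ext z
  simp only [Finset.mem_image, Finset.mem_univ, true_and, Finset.mem_range, window, zero_add]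
  exact ⟨fun ⟨i, hi⟩ => ⟨i, i.2, hi⟩, fun ⟨i, hi, h⟩ => ⟨⟨i, hi⟩, h⟩⟩

theorem window_mem_tropicalRecurrent {y : ℕ → ℝ} {t : ℕ} (hy : IsRecurrent a y t) :
    window (t + n) y 0 ∈ tropicalRecurrent a (t + n) := by
  intro j hj
  simpa [window] using hy j (by omega)

theorem exists_seq_of_mem_tropicalRecurrent {t : ℕ} {x : Fin (t + n) → ℝ}
    (hx : x ∈ tropicalRecurrent a (t + n)) :
    ∃ y : ℕ → ℝ, window (t + n) y 0 = x ∧ IsRecurrent a y t := by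
  refine ⟨fun i => if h : i < t + n then x ⟨i, h⟩ else 0, ?_, fun j hj => ?_⟩
  · ext i
    simp [window]
  · convert hx j (by omega) using 3 with i
    exact dif_pos _

/-- The maximal number of classes modulo integers of the coordinates of a window of the type `u`. -/
noncomputable def typeClasses (u : WindowType n M) : ℕ :=
  sSup {r | ∃ x : Fin n → ℝ, windowType M x = u ∧ numClasses x = r}

theorem bddAbove_typeClasses (u : WindowType n M) :
    n ∈ upperBounds {r | ∃ x : Fin n → ℝ, windowType M x = u ∧ numClasses x = r} := by
  rintro _ ⟨x, -, rfl⟩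
  simpa using numClasses_le x

theorem typeClasses_nonempty (u : WindowType n M) :
    {r | ∃ x : Fin n → ℝ, windowType M x = u ∧ numClasses x = r}.Nonempty := by
  obtain ⟨x, rfl⟩ := Quotient.exists_rep u
  exact ⟨_, x, rfl, rfl⟩

theorem typeClasses_le (u : WindowType n M) : typeClasses u ≤ n :=
  csSup_le (typeClasses_nonempty u) (bddAbove_typeClasses u)

theorem numClasses_le_typeClasses (x : Fin n → ℝ) : numClasses x ≤ typeClasses (windowType M x) :=
  le_csSup ⟨n, bddAbove_typeClasses _⟩ ⟨x, rfl, rfl⟩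

theorem exists_numClasses_eq (u : WindowType n M) :
    ∃ x : Fin n → ℝ, windowType M x = u ∧ numClasses x = typeClasses u :=
  Nat.sSup_mem (typeClasses_nonempty u) ⟨n, bddAbove_typeClasses u⟩

/-- A new class modulo integers in a recurrent sequence appears at an edge of weight `1`. -/
theorem IsRecurrent.exists_walk (M : ℕ) {y : ℕ → ℝ} {t : ℕ} (hy : IsRecurrent a y t) :
    ∃ k, Walk (TypeStep a M) (windowType M (window n y 0)) (windowType M (window n y t)) t k ∧
      (seqClasses y (t + n)).card ≤ (seqClasses y n).card + k := by
  induction t with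
  | zero => exact ⟨0, .nil _, by simp⟩
  | succ t ih =>
    obtain ⟨k, hw, hk⟩ := ih fun j hj => hy j (by omega)
    have hstep : ∀ b, (b = 0 ∨ b = 1 ∧ Int.fract (y (t + n)) ∉ seqClasses y (t + n)) →
        TypeStep a M (windowType M (window n y t)) (windowType M (window n y (t + 1))) b := by
      intro b hb
      refine ⟨window (n + 1) y t, hy t (by omega), ?_, ?_, hb.imp id fun h => ⟨h.1, ?_⟩⟩
      · rw [window_succ_comp_castSucc]
      · rw [window_succ_comp_succ]
      · intro i _ heq
        refine h.2 (Finset.mem_image.mpr ⟨t + i, Finset.mem_range.mpr (by omega), ?_⟩)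
        simpa [window] using heq.symm
    rw [show t + 1 + n = t + n + 1 by omega, seqClasses_succ]
    by_cases hmem : Int.fract (y (t + n)) ∈ seqClasses y (t + n)
    · exact ⟨_, hw.snoc (hstep 0 (.inl rfl)), by rwa [Finset.insert_eq_of_mem hmem]⟩
    · refine ⟨_, hw.snoc (hstep 1 (.inr ⟨rfl, hmem⟩)), ?_⟩
      rw [Finset.card_insert_of_notMem hmem]
      omega

/-- Each walk is followed by a recurrent sequence which has a new class modulo integers at each edge
of weight `1`. -/
theorem Walk.exists_isRecurrent (ha : ∀ i k, a i - a k ≤ (M : ℤ)) {u v : WindowType n M} {t k : ℕ}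
    (h : Walk (TypeStep a M) u v t k) :
    ∃ y : ℕ → ℝ, IsRecurrent a y t ∧ windowType M (window n y t) = v ∧
      typeClasses u + k ≤ (seqClasses y (t + n)).card := by
  induction h with
  | nil =>
    obtain ⟨x, hx, hxu⟩ := exists_numClasses_eq u
    let y : ℕ → ℝ := fun i => if h : i < n then x ⟨i, h⟩ else 0
    have hy : window n y 0 = x := by
      ext i
      simp [window, y]
    refine ⟨y, fun j hj => absurd hj (Nat.not_lt_zero j), by rw [hy, hx], ?_⟩
    rw [zero_add, ← numClasses_window, hy, hxu, add_zero]
  | @snoc v w t k b _ e ih =>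
    obtain ⟨y, hy, hyv, hk⟩ := ih
    obtain ⟨X', hX', hv, hw, hb⟩ := e
    obtain ⟨r, hr, hrF⟩ := exists_transfer (hyv.trans hv.symm) (seqClasses y (t + n))
    let z : ℕ → ℝ := Function.update y (t + n) r
    have hz : ∀ i, i ≠ t + n → z i = y i := fun i hi => Function.update_of_ne hi _ _
    have hzr : z (t + n) = r := Function.update_self _ _ _
    have hwin : window (n + 1) z t ∘ Fin.castSucc = window n y t := by
      ext i
      exact hz _ (by simp only [Fin.val_castSucc]; omega)
    have hsame := hr (window (n + 1) z t) hwin hzr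
    rw [← hwin] at hsame hyv
    have hbdd := (windowType_eq_iff.1 (hyv.trans hv.symm)).1
    have hsame' : SameOn (extBdd M (X' ∘ Fin.castSucc)) X' (window (n + 1) z t) :=
      hsame.symm.mono fun i hi k hk => (hbdd k).2 (hi k hk)
    refine ⟨z, fun j hj => ?_, ?_, ?_⟩
    · rcases Nat.lt_succ_iff_lt_or_eq.mp hj with hj | rfl
      · convert hy j hj using 3 with i
        exact hz _ (by omega)
      · exact hX'.of_sameOn ha (fun i => (hbdd i).symm) hsame'
    · rw [← window_succ_comp_succ, ← hw]
      exact (windowType_succ_eq ha (fun i => (hbdd i).symm) hsame' hX').symm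
    · have hcl : seqClasses z (t + n) = seqClasses y (t + n) := by
        refine Finset.image_congr fun i hi => ?_
        have hi : i < t + n := by simpa using hi
        simp only [hz i hi.ne]
      rw [show t + 1 + n = t + n + 1 by omega, seqClasses_succ, hcl, hzr]
      rcases hb with rfl | ⟨rfl, hfr⟩
      · exact hk.trans (Finset.card_le_card (Finset.subset_insert _ _))
      · rw [Finset.card_insert_of_notMem (hrF hfr)]
        omega

/-- The tropical Hilbert function as a maximum over walks. -/
theorem isMaxWeight_tropicalHilbert (hn : 1 ≤ n) (ha : ∀ i k, a i - a k ≤ (M : ℤ)) :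
    IsMaxWeight (TypeStep a M) typeClasses fun t => tropicalHilbert a (t + n) where
  le u v t k h := by
    obtain ⟨y, hy, -, hk⟩ := h.exists_isRecurrent ha
    refine hk.trans ?_
    rw [← numClasses_window]
    exact numClasses_le_tropicalHilbert a (window_mem_tropicalRecurrent hy)
  attained t := by
    have hne : (tropicalRecurrent a (t + n)).Nonempty := by
      obtain ⟨v, k, h⟩ := exists_walk_of_length (TypeStep.exists (M := M) (a := a) hn)
        (windowType M fun _ => 0) t
      obtain ⟨y, hy, -⟩ := h.exists_isRecurrent ha
      exact ⟨_, window_mem_tropicalRecurrent hy⟩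
    obtain ⟨x, hx, hle⟩ := exists_tropicalHilbert_le a hne
    obtain ⟨y, rfl, hy⟩ := exists_seq_of_mem_tropicalRecurrent hx
    obtain ⟨k, hw, hk⟩ := hy.exists_walk M
    refine ⟨_, _, k, hw, hle.trans ?_⟩
    rw [numClasses_window]
    refine hk.trans (Nat.add_le_add_right ?_ k)
    rw [← numClasses_window]
    exact numClasses_le_typeClasses _

end

/-! ### The number of types -/

section

variable {n M : ℕ}

/-- The windows of the type of `x` form a vertex of the graph `G_a`. -/
theorem fiber_mem_graphVertices (hn : 1 ≤ n) (x : Fin n → ℝ) :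
    {y | windowType M x = windowType M y} ∈ graphVertices n M := by
  have : Nonempty (Fin n) := ⟨⟨0, hn⟩⟩
  obtain ⟨p, hp⟩ := Finite.exists_min x
  let v : VertexData n :=
    { bdd := {i | IsBdd M x i}
      s₀ := p
      s₀_mem := IsBdd.of_min hp
      m := fun k l => ⌈x k - x l⌉
      isEq := fun k l => x k - x l = ⌈x k - x l⌉ }
  refine ⟨⟨x, rfl⟩, v, fun k l hk hl _ => ?_, ?_⟩
  · have hk' : (k : ℕ) + 1 ≤ n := k.2
    have hl' : (l : ℕ) + 1 ≤ n := l.2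
    have h1 : ⌈x k - x l⌉ ≤ ((k : ℕ) + 1) * (M : ℤ) := by
      rw [Int.ceil_le]
      push_cast
      exact hk l
    have h2 : -(((l : ℕ) + 1) * (M : ℤ)) ≤ ⌈x k - x l⌉ := by
      have h3 : (-((((l : ℕ) : ℝ) + 1) * M)) ≤ ⌈x k - x l⌉ :=
        le_trans (by linarith [hl k]) (Int.le_ceil _)
      exact_mod_cast h3
    have hM : (0 : ℤ) ≤ M := Int.natCast_nonneg M
    have hk'' : ((k : ℕ) : ℤ) + 1 ≤ n := by exact_mod_cast hk'
    have hl'' : ((l : ℕ) : ℤ) + 1 ≤ n := by exact_mod_cast hl'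
    exact ⟨by simp only [v]; nlinarith, by simp only [v]; nlinarith⟩
  ext y
  constructor
  · intro h
    have hp' := min_of_windowType_eq h hp
    obtain ⟨hb, hs⟩ := windowType_eq_iff.1 h
    refine ⟨hp', fun k l hk hl _ => ⟨fun heq => ?_, fun hne => ?_⟩, fun j hj => ?_⟩
    · have heq : x k - x l = ⌈x k - x l⌉ := heq
      have h1 := (hs k hk l hl _).1 heq.ge
      have h2 := (hs.sub_le_iff hk hl _).1 heq.le
      simp only [v]
      linarith
    · have hne : x k - x l ≠ ⌈x k - x l⌉ := hne
      have h1 := (hs.sub_le_iff hk hl _).1 (Int.le_ceil (x k - x l))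
      have h2 : ¬ ((⌈x k - x l⌉ : ℤ) : ℝ) ≤ y k - y l := fun h =>
        hne (le_antisymm (Int.le_ceil _) ((hs k hk l hl _).2 h))
      have h3 : ¬ y k - y l ≤ ((⌈x k - x l⌉ - 1 : ℤ) : ℝ) := fun h => by
        have := (hs.sub_le_iff hk hl _).2 h
        push_cast at this
        linarith [Int.ceil_lt_add_one (x k - x l)]
      push_cast at h3
      simp only [v]
      constructor <;> linarith
    · have hj : ¬ IsBdd M x j := hj
      rw [hb, isBdd_iff_of_min hp'] at hj
      push_cast at hj
      exact not_le.mp hj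
  · rintro ⟨hp', ht, hu⟩
    have hkl : ∀ k l, IsBdd M x k → IsBdd M x l → k < l → ∀ m : ℤ,
        ((m : ℝ) ≤ x k - x l ↔ (m : ℝ) ≤ y k - y l) ∧
        ((m : ℝ) ≤ -(x k - x l) ↔ (m : ℝ) ≤ -(y k - y l)) := by
      intro k l hk hl hlt m
      obtain ⟨h1, h2⟩ := ht k l hk hl hlt
      by_cases heq : x k - x l = ⌈x k - x l⌉
      · have h3 : y k = y l + ((⌈x k - x l⌉ : ℤ) : ℝ) := h1 heq
        rw [← heq] at h3
        have h4 : y k - y l = x k - x l := by linarith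
        rw [h4]
        exact ⟨Iff.rfl, Iff.rfl⟩
      · obtain ⟨h3, h4⟩ := h2 heq
        simp only [v] at h3 h4
        have h5 : x k - x l < ⌈x k - x l⌉ := lt_of_le_of_ne (Int.le_ceil _) heq
        have h6 := Int.ceil_lt_add_one (x k - x l)
        refine le_iff_of_mem_Ioo (m := ⌈x k - x l⌉ - 1) ⟨?_, ?_⟩ ⟨?_, ?_⟩ m <;>
          push_cast <;> linarith
    have hs : SameOn {i | IsBdd M x i} x y := by
      intro k hk l hl m
      rcases lt_trichotomy k l with h | rfl | h
      · exact (hkl k l hk hl h m).1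
      · simp
      · simpa only [neg_sub] using (hkl l k hl hk h m).2
    refine windowType_eq_iff.2 ⟨fun i => ?_, hs⟩
    by_cases hi : IsBdd M x i
    · refine iff_of_true hi ((isBdd_iff_of_min hp' i).2 ?_)
      exact (hs.sub_le_iff hi (IsBdd.of_min hp) _).1 ((isBdd_iff_of_min hp i).1 hi)
    · refine iff_of_false hi fun h => ?_
      exact absurd (h p) (not_le.mpr (hu i hi))

theorem card_windowType_le_numVertices (hn : 1 ≤ n) :
    Nat.card (WindowType n M) ≤ numVertices n M := by
  have : Finite (graphVertices n M) := graphVertices_finite n M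
  let f : WindowType n M → graphVertices n M := fun u =>
    ⟨{y | windowType M u.out = windowType M y}, fiber_mem_graphVertices hn _⟩
  have hout : ∀ u : WindowType n M, windowType M u.out = u := fun u => Quotient.out_eq u
  refine Nat.card_le_card_of_injective f fun u u' h => ?_
  have h1 : u'.out ∈ {y | windowType M u.out = windowType M y} := by
    have h2 := congrArg Subtype.val h
    simp only [f] at h2
    rw [h2]
    rfl
  rw [← hout u, ← hout u']
  exact h1

theorem intCast_le_sub_iff (u v : ℝ) (m : ℤ) :
    (m : ℝ) ≤ u - v ↔ m < ⌊u⌋ - ⌊v⌋ ∨ m ≤ ⌊u⌋ - ⌊v⌋ ∧ Int.fract v ≤ Int.fract u := by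
  have hu := Int.floor_add_fract u
  have hv := Int.floor_add_fract v
  have hu0 := Int.fract_nonneg u
  have hv0 := Int.fract_nonneg v
  have hu1 := Int.fract_lt_one u
  have hv1 := Int.fract_lt_one v
  constructor
  · intro h
    by_contra! hne
    obtain ⟨h1, h2⟩ := hne
    have h4 : (m : ℝ) < ((⌊u⌋ - ⌊v⌋ + 1 : ℤ) : ℝ) := by push_cast; linarith
    have h5 : m < ⌊u⌋ - ⌊v⌋ + 1 := by exact_mod_cast h4
    have h6 := h2 (by omega)
    have h7 : (m : ℝ) < ((⌊u⌋ - ⌊v⌋ : ℤ) : ℝ) := by push_cast; linarith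
    have h8 : m < ⌊u⌋ - ⌊v⌋ := by exact_mod_cast h7
    omega
  · rintro (h | ⟨h, h'⟩)
    · have h1 : ((m + 1 : ℤ) : ℝ) ≤ ((⌊u⌋ - ⌊v⌋ : ℤ) : ℝ) := by exact_mod_cast h
      push_cast at h1
      linarith
    · have h1 : (m : ℝ) ≤ ((⌊u⌋ - ⌊v⌋ : ℤ) : ℝ) := by exact_mod_cast h
      push_cast at h1
      linarith

/-- A type is determined by the set of bounded coordinates, the floors of their distances from the
minimal coordinate, and the ranks of the fractional parts of these distances. -/
theorem exists_injective_key (hn : 1 ≤ n) (M : ℕ) :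
    ∃ f : WindowType n M → Set (Fin n) × (Fin n → Fin (n * M + 1)) × (Fin n → Fin n),
      Function.Injective f := by
  classical
  have : Nonempty (Fin n) := ⟨⟨0, hn⟩⟩
  have hex : ∀ u : WindowType n M, ∃ (x : Fin n → ℝ) (p : Fin n), windowType M x = u ∧
      ∀ j, x p ≤ x j := by
    intro u
    obtain ⟨x, hx⟩ := Quotient.exists_rep u
    obtain ⟨p, hp⟩ := Finite.exists_min x
    exact ⟨x, p, hx, hp⟩
  choose x p hx hp using hex
  let z : WindowType n M → Fin n → ℝ := fun u i => x u i - x u (p u)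
  let lower : WindowType n M → Fin n → Finset (Fin n) := fun u i =>
    Finset.univ.filter fun j => IsBdd M (x u) j ∧ Int.fract (z u j) < Int.fract (z u i)
  have hlower : ∀ u i, (lower u i).card < n := by
    intro u i
    have := Finset.card_lt_univ_of_notMem (s := lower u i) (x := i) (by simp [lower])
    simpa using this
  have hrank : ∀ u i j, IsBdd M (x u) i →
      (Int.fract (z u j) ≤ Int.fract (z u i) ↔ (lower u j).card ≤ (lower u i).card) := by
    intro u i j hi
    constructor
    · intro h
      refine Finset.card_le_card fun k hk => ?_
      have hk := (Finset.mem_filter.mp hk).2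
      exact Finset.mem_filter.mpr ⟨Finset.mem_univ k, hk.1, hk.2.trans_le h⟩
    · intro h
      by_contra! hlt
      refine absurd (Finset.card_lt_card ((Finset.ssubset_iff_of_subset fun k hk => ?_).mpr
        ⟨i, Finset.mem_filter.mpr ⟨Finset.mem_univ i, hi, hlt⟩, by simp [lower]⟩)) (not_lt.mpr h)
      have hk := (Finset.mem_filter.mp hk).2
      exact Finset.mem_filter.mpr ⟨Finset.mem_univ k, hk.1, hk.2.trans hlt⟩
  have hz0 : ∀ u i, 0 ≤ ⌊z u i⌋ := fun u i => Int.floor_nonneg.mpr (sub_nonneg.mpr (hp u i))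
  have hzM : ∀ u i, IsBdd M (x u) i → ⌊z u i⌋ ≤ ((n * M : ℕ) : ℤ) := by
    intro u i hi
    have h1 : z u i ≤ ((n * M : ℕ) : ℝ) := by
      refine (hi (p u)).trans ?_
      have : (((i : ℕ) + 1 : ℕ) : ℝ) ≤ n := by exact_mod_cast i.2
      push_cast at this ⊢
      gcongr
    have h2 : ((⌊z u i⌋ : ℤ) : ℝ) ≤ ((n * M : ℕ) : ℝ) := (Int.floor_le _).trans h1
    exact_mod_cast h2
  refine ⟨fun u => ({i | IsBdd M (x u) i},
    fun i => ⟨min ⌊z u i⌋.toNat (n * M), by omega⟩, fun i => ⟨(lower u i).card, hlower u i⟩),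
    fun u u' h => ?_⟩
  simp only [Prod.mk.injEq] at h
  obtain ⟨h1, h2, h3⟩ := h
  have hb : ∀ i, IsBdd M (x u) i ↔ IsBdd M (x u') i := fun i => Set.ext_iff.1 h1 i
  have hfl : ∀ i, IsBdd M (x u) i → ⌊z u i⌋ = ⌊z u' i⌋ := by
    intro i hi
    have h4 := congrArg Fin.val (congrFun h2 i)
    simp only at h4
    have := hz0 u i
    have := hz0 u' i
    have := hzM u i hi
    have := hzM u' i ((hb i).1 hi)
    omega
  have hcard : ∀ i, (lower u i).card = (lower u' i).card := fun i =>
    congrArg Fin.val (congrFun h3 i)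
  rw [← hx u, ← hx u']
  refine windowType_eq_iff.2 ⟨hb, fun i hi j hj m => ?_⟩
  have hi : IsBdd M (x u) i := hi
  have hj : IsBdd M (x u) j := hj
  have e1 : x u i - x u j = z u i - z u j := by simp only [z]; ring
  have e2 : x u' i - x u' j = z u' i - z u' j := by simp only [z]; ring
  rw [e1, e2, intCast_le_sub_iff, intCast_le_sub_iff, hfl i hi, hfl j hj, hrank u i j hi,
    hrank u' i j ((hb i).1 hi), hcard, hcard]

theorem finite_windowType (hn : 1 ≤ n) (M : ℕ) : Finite (WindowType n M) := by
  obtain ⟨f, hf⟩ := exists_injective_key hn M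
  exact Finite.of_injective f hf

theorem card_windowType_le (hn : 1 ≤ n) (M : ℕ) :
    Nat.card (WindowType n M) ≤ (4 * n ^ 2 * max M 1) ^ n := by
  obtain ⟨f, hf⟩ := exists_injective_key hn M
  have h1 := Nat.card_le_card_of_injective f hf
  have h2 : Nat.card (Set (Fin n) × (Fin n → Fin (n * M + 1)) × (Fin n → Fin n)) =
      2 ^ n * ((n * M + 1) ^ n * n ^ n) := by
    simp
  have h3 : n * M + 1 ≤ 2 * n * max M 1 := by
    have h4 : n * M ≤ n * max M 1 := Nat.mul_le_mul_left _ (le_max_left _ _)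
    have h5 : 1 * 1 ≤ n * max M 1 := Nat.mul_le_mul hn (le_max_right _ _)
    nlinarith
  calc Nat.card (WindowType n M) ≤ 2 ^ n * ((n * M + 1) ^ n * n ^ n) := h1.trans_eq h2
    _ ≤ 2 ^ n * ((2 * n * max M 1) ^ n * n ^ n) := by gcongr
    _ = (4 * n ^ 2 * max M 1) ^ n := by
      rw [← mul_pow, ← mul_pow]
      congr 1
      ring

end

/-! ### Numerical estimates -/

/-- With `B = (2 n √M') ^ n`, the hypotheses give `N ≤ B ^ 2` and `r ≤ 2 B`, whereas
`log N ≤ 4 n ^ 2 √M'`. -/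
theorem pow_lt_exp {n M' N r : ℕ} (hn : 1 ≤ n) (hM : 1 ≤ M') (hN : 1 ≤ N)
    (hNle : N ≤ (4 * n ^ 2 * M') ^ n) (hr : r * r ≤ 2 * N) :
    ((N ^ r : ℕ) : ℝ) < Real.exp ((128 * (M' : ℝ) * n) ^ n) := by
  have hnR : (1 : ℝ) ≤ n := by exact_mod_cast hn
  have hMR : (1 : ℝ) ≤ M' := by exact_mod_cast hM
  have hNR : (1 : ℝ) ≤ N := by exact_mod_cast hN
  set S := Real.sqrt M' with hS
  have hS1 : 1 ≤ S := Real.one_le_sqrt.mpr hMR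
  have hSS : S * S = M' := Real.mul_self_sqrt (by linarith)
  set B : ℝ := (2 * n * S) ^ n with hB
  have hbase : 0 < 2 * (n : ℝ) * S := by positivity
  have hB0 : 0 < B := by positivity
  have hNB : (N : ℝ) ≤ B ^ 2 := by
    have h1 : (N : ℝ) ≤ (4 * (n : ℝ) ^ 2 * M') ^ n := by exact_mod_cast hNle
    have h2 : (4 * (n : ℝ) ^ 2 * M') ^ n = B ^ 2 := by
      rw [hB, ← pow_mul, mul_comm n 2, pow_mul, ← hSS]
      congr 1
      ring
    rwa [h2] at h1
  have hrB : (r : ℝ) ≤ 2 * B := by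
    have h1 : (r : ℝ) * r ≤ 2 * N := by exact_mod_cast hr
    exact abs_le_of_sq_le_sq' (by nlinarith) (by positivity) |>.2
  have hlog : Real.log N ≤ 4 * (n : ℝ) ^ 2 * S := by
    calc Real.log N ≤ Real.log (B ^ 2) := Real.log_le_log (by linarith) hNB
      _ = 2 * (n * Real.log (2 * n * S)) := by
        rw [Real.log_pow, hB, Real.log_pow]
        norm_num
      _ ≤ 2 * (n * (2 * n * S)) := by
        gcongr
        exact Real.log_le_self hbase.le
      _ = 4 * (n : ℝ) ^ 2 * S := by ring
  have hn2 : (n : ℝ) ≤ 2 ^ n := by exact_mod_cast Nat.lt_two_pow_self.le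
  have hSn : S ≤ S ^ n := le_self_pow₀ hS1 (by omega)
  have h0 : r * Real.log N < (128 * (M' : ℝ) * n) ^ n := by
    calc r * Real.log N ≤ 2 * B * (4 * (n : ℝ) ^ 2 * S) := by
          gcongr
      _ ≤ 2 * B * (4 * ((2 : ℝ) ^ n) ^ 2 * S ^ n) := by gcongr
      _ = 8 * (8 * (M' : ℝ) * n) ^ n := by
        rw [hB, ← hSS]
        simp only [mul_pow]
        rw [← pow_mul, mul_comm n 2, pow_mul, show (8 : ℝ) = 2 * 2 ^ 2 by norm_num]
        simp only [mul_pow]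
        ring
      _ < 16 ^ n * (8 * (M' : ℝ) * n) ^ n := by
        have h16 : (8 : ℝ) < 16 ^ n := by
          calc (8 : ℝ) < 16 ^ 1 := by norm_num
            _ ≤ 16 ^ n := pow_le_pow_right₀ (by norm_num) hn
        gcongr
      _ = (128 * (M' : ℝ) * n) ^ n := by
        rw [← mul_pow]
        congr 1
        ring
  calc ((N ^ r : ℕ) : ℝ) = Real.exp (r * Real.log N) := by
        rw [mul_comm, Real.exp_mul, Real.exp_log (by linarith)]
        simp
    _ < _ := Real.exp_lt_exp.mpr h0

theorem tendsto_div_of_bounded {d : ℕ → ℕ} {H K : ℝ} {n : ℕ}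
    (h : ∀ s, n ≤ s → |(d s : ℝ) - H * s| ≤ K) :
    Tendsto (fun s : ℕ => (d s : ℝ) / s) atTop (𝓝 H) := by
  rw [tendsto_iff_norm_sub_tendsto_zero]
  refine squeeze_zero' (Eventually.of_forall fun _ => norm_nonneg _) ?_
    (tendsto_const_div_atTop_nhds_zero_nat K)
  filter_upwards [eventually_ge_atTop n, eventually_gt_atTop 0] with s hs hs0
  have hs' : (0 : ℝ) < s := by exact_mod_cast hs0
  rw [Real.norm_eq_abs, show (d s : ℝ) / s - H = (d s - H * s) / s by field_simp, abs_div,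
    abs_of_pos hs']
  gcongr
  exact h s hs

/-- The hypothesis on `s`, stated with the number `V` of vertices of `G_a`, is stronger than what the
graph of types with its `N ≤ V` vertices requires of the length `s - n` of walks. -/
theorem transient_bound {N V n s : ℕ} {H : ℝ} (hN : 1 ≤ N) (hNV : N ≤ V) (hH : H ≤ 1)
    (hs : ((V : ℝ) ^ 2 + 1) * (V + n) + V * ((1 - H) * V + n + 1) ^ 2 < s) :
    n ≤ s ∧ N ^ 2 * (N + n) + N < s - n ∧ 2 * N ^ 2 ≤ s - n := by
  have hV1 : (1 : ℝ) ≤ V := by exact_mod_cast hN.trans hNV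
  have h1 : (1 : ℝ) ≤ (1 - H) * V + n + 1 := by
    have : 0 ≤ (1 - H) * V := mul_nonneg (by linarith) (by linarith)
    have : (0 : ℝ) ≤ n := Nat.cast_nonneg n
    linarith
  have h2 : (1 : ℝ) ≤ ((1 - H) * V + n + 1) ^ 2 := one_le_pow₀ h1
  have h3 : ((V : ℝ) ^ 2 + 1) * (V + n) + V < s := by nlinarith
  have h4 : (V ^ 2 + 1) * (V + n) + V < s := by exact_mod_cast h3
  have h5 : (N ^ 2 + 1) * (N + n) + N ≤ (V ^ 2 + 1) * (V + n) + V := by gcongr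
  have h6 : 2 * N ^ 2 ≤ N ^ 2 * (N + n) + N + N := by nlinarith [sq_nonneg ((N : ℤ) - 1)]
  have h7 : (N ^ 2 + 1) * (N + n) + N = N ^ 2 * (N + n) + N + N + n := by ring
  omega

theorem theorem5p5 :
    ∃ C : ℝ, 0 < C ∧
      ∀ (n : ℕ), 1 ≤ n → ∀ (M : ℕ) (a : Fin (n + 1) → ℤ), (∀ i k, a i - a k ≤ (M : ℤ)) →
        Tendsto (fun s : ℕ => (tropicalHilbert a s : ℝ) / (s : ℝ)) atTop
          (𝓝 (tropicalEntropy a)) ∧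
        ∃ R : ℕ, 1 ≤ R ∧
          (R : ℝ) < Real.exp ((C * ((max M 1 : ℕ) : ℝ) * (n : ℝ)) ^ n) ∧
          ∀ s : ℕ,
            ((numVertices n M : ℝ) ^ 2 + 1) * ((numVertices n M : ℝ) + (n : ℝ)) +
                (numVertices n M : ℝ) *
                  ((1 - tropicalEntropy a) * (numVertices n M : ℝ) + (n : ℝ) + 1) ^ 2 < (s : ℝ) →
            (tropicalHilbert a (s + R) : ℝ) = (tropicalHilbert a s : ℝ) + tropicalEntropy a * R := by
  refine ⟨128, by norm_num, fun n hn M a ha => ?_⟩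
  have : Finite (WindowType n M) := finite_windowType hn M
  let _ : Fintype (WindowType n M) := Fintype.ofFinite _
  have : Nonempty (WindowType n M) := ⟨windowType M fun _ => 0⟩
  have hE := TypeStep.exists (M := M) (a := a) hn
  have hb : ∀ u v b, TypeStep a M u v b → b ≤ 1 := fun _ _ _ h => h.weight_le
  have hg : ∀ u : WindowType n M, typeClasses u ≤ n := typeClasses_le
  have hd := isMaxWeight_tropicalHilbert hn ha
  obtain ⟨p, q, hm⟩ := exists_isMaxMean hE hb
  obtain ⟨R, r, hR1, hr, hRr, hR⟩ := exists_common_period hm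
  set N := Fintype.card (WindowType n M) with hN
  have hN1 : 1 ≤ N := Fintype.card_pos
  have hcard : Nat.card (WindowType n M) = N := Nat.card_eq_fintype_card
  have hq : (0 : ℝ) < q := by exact_mod_cast hm.pos
  have hpq : (p : ℝ) ≤ q := by exact_mod_cast hm.le hb
  have hlim : Tendsto (fun s : ℕ => (tropicalHilbert a s : ℝ) / (s : ℝ)) atTop
      (𝓝 ((p : ℝ) / q)) := by
    refine tendsto_div_of_bounded (n := n) (K := (n + N) + p + (p : ℝ) * n / q) fun s hs => ?_
    obtain ⟨t, rfl⟩ := Nat.exists_eq_add_of_le' hs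
    have h1 : (p : ℝ) * t ≤ q * tropicalHilbert a (t + n) + p * q := by
      exact_mod_cast hd.lower hm hE t
    have h2 : (q : ℝ) * tropicalHilbert a (t + n) ≤ p * t + q * (n + N) := by
      exact_mod_cast hd.upper hm hb hg t
    have h3 : (tropicalHilbert a (t + n) : ℝ) - p / q * ((t + n : ℕ) : ℝ) =
        (q * tropicalHilbert a (t + n) - p * t) / q - p * n / q := by
      push_cast
      field_simp
      ring
    have h4 : ((q : ℝ) * tropicalHilbert a (t + n) - p * t) / q ≤ n + N := by
      rw [div_le_iff₀ hq]
      linarith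
    have h5 : -(p : ℝ) ≤ ((q : ℝ) * tropicalHilbert a (t + n) - p * t) / q := by
      rw [le_div_iff₀ hq]
      linarith
    have h6 : (0 : ℝ) ≤ p * n / q := by positivity
    have h7 : (0 : ℝ) ≤ p := Nat.cast_nonneg p
    have h8 : (0 : ℝ) ≤ (n : ℝ) + N := by positivity
    rw [h3, abs_le]
    constructor <;> linarith
  have hH : tropicalEntropy a = (p : ℝ) / q := hlim.limUnder_eq
  refine ⟨hH ▸ hlim, R, hR1, ?_, fun s hs => ?_⟩
  · refine lt_of_le_of_lt (by exact_mod_cast hRr)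
      (pow_lt_exp hn (le_max_right M 1) hN1 (hcard ▸ card_windowType_le hn M) hr)
  · have hH1 : tropicalEntropy a ≤ 1 := by
      rw [hH]
      exact (div_le_one hq).mpr hpq
    obtain ⟨h1, h2, h3⟩ :=
      transient_bound hN1 (hcard ▸ card_windowType_le_numVertices hn) hH1 hs
    obtain ⟨t, rfl⟩ := Nat.exists_eq_add_of_le' h1
    rw [Nat.add_sub_cancel] at h2 h3
    have h4 := hd.add_period hm hE hb hg hR h2 h3
    rw [show t + n + R = t + R + n by omega, hH]
    have h5 : (q : ℝ) * tropicalHilbert a (t + R + n) = q * tropicalHilbert a (t + n) + p * R := by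
      exact_mod_cast h4
    field_simp
    linarith
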